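/- Let $B\in[0,1]^{K\times K}$ have rank $d$, and let $\tilde\pi,\tilde b,\hat\beta>0$ be constants (not depending on $N$). There is an $N_0$, depending only on $B,\tilde\pi,\tilde b,\hat\beta$, such that the following holds for every $N\ge N_0$. Let $\tau:[N]\to[K]$ be a block membership function with block sizes $n_i=|\{u:\tau(u)=i\}|$, let $D_n=\mathrm{diag}(n_1,\dots,n_K)$ and $\tilde B=BD_nB$. Assume that * $n_i\ge\tilde\pi N$ for all $i\in[K]$; * the $d$-th largest singular value of $\tilde B$ is at least $\tilde b N$; * $\tilde B=\tilde\nu\tilde\mu^\top$ with $\tilde\nu,\tilde\mu\in\mathbb R^{K\times d}$ such that, for all $u\ne v$, $\|\tilde\nu_u-\tilde\nu_v\|>\hat\beta N$ or $\|\tilde\mu_u-\tilde\mu_v\|>\hat\beta N$, where subscripts denote rows and $\|\cdot\|$ is the Euclidean norm. Let $A\in\{0,1\}^{N\times N}$ be the adjacency matrix of a directed stochastic block model with memberships $\tau$ and without self-loops: $A_{ii}=0$, and the entries $A_{ij}$, $i\ne j$ (all ordered pairs), are independent with $A_{ij}\sim\mathrm{Bernoulli}(B_{\tau(i)\tau(j)})$.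 Let $\tilde A=AA$, let $\tilde U,\tilde V\in\mathbb R^{N\times d}$ consist of the top $d$ left and right singular vectors of $\tilde A$ taken from a singular value decomposition of $\tilde A$, and let $\tilde W=[\tilde U|\tilde V]\in\mathbb R^{N\times 2d}$. Let $(\hat\nu,\hat\tau)$, with centroids $\hat\nu_1,\dots,\hat\nu_K\in\mathbb R^{2d}$ and $\hat\tau:[N]\to[K]$, be a minimiser of the $k$-means criterion $$\sum_{u=1}^N\|\tilde W_u-\nu_{t(u)}\|^2$$ over all centroids $\nu_1,\dots,\nu_K\in\mathbb R^{2d}$ and all assignments $t:[N]\to[K]$. Let $H_K$ be the set of permutations of $[K]$. Then, with probability at least $1-2N^{-2}$, for every such choice of the singular value decomposition and of the minimiser, $$\min_{\rho\in H_K}\bigl|\{u\in[N]:\tau(u)\ne\rho(\hat\tau(u))\}\bigr|\le\frac{2^5\,3^2}{\hat\beta^2(\tilde b\,\tilde\pi)^5}\cdot\frac{\log N}{N}.$$ -/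

import Mathlib

open MeasureTheory ProbabilityTheory

noncomputable section

namespace DASE

/-- The number of nodes in block `i` under the membership function `τ`. -/
def blockSize {N K : ℕ} (τ : Fin N → Fin K) (i : Fin K) : ℕ :=
  (Finset.univ.filter fun u => τ u = i).card

/-- The adjacency matrix `A` of a random directed graph without self-loops on the nodes `Fin N`
follows the directed stochastic block model with block probability matrix `B`, given the block
memberships `τ`: the entries are 0 or 1, the diagonal vanishes, and the entries indexed by the
ordered pairs `(i, j)` with `i ≠ j` are independent, with `P(A i j = 1) = B (τ i) (τ j)`. -/
structure IsDirectedSBM {N K : ℕ} (B : Matrix (Fin K) (Fin K) ℝ) (τ : Fin N → Fin K)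
    {Ω : Type*} [MeasurableSpace Ω] (μ : Measure Ω)
    (A : Ω → Matrix (Fin N) (Fin N) ℝ) : Prop where
  measurable_entry : ∀ i j, Measurable fun ω => A ω i j
  zero_or_one : ∀ ω i j, A ω i j = 0 ∨ A ω i j = 1
  no_loops : ∀ ω i, A ω i i = 0
  prob_edge : ∀ i j, i ≠ j → μ.real {ω | A ω i j = 1} = B (τ i) (τ j)
  indep : iIndepFun (fun (p : {p : Fin N × Fin N // p.1 ≠ p.2}) ω => A ω p.1.1 p.1.2) μ

/-- The matrix `B̃ = B Dₙ B`, where `Dₙ` is the diagonal matrix of the block sizes. -/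
def doubledBlockMatrix {N K : ℕ} (B : Matrix (Fin K) (Fin K) ℝ) (τ : Fin N → Fin K) :
    Matrix (Fin K) (Fin K) ℝ :=
  B * Matrix.diagonal (fun i => (blockSize τ i : ℝ)) * B

/-- The `k`-th largest singular value (`k = 1, 2, …`, with multiplicity) of a real matrix;
Mathlib's sequence of singular values is indexed from 0. -/
def singularValue {m n : ℕ} (M : Matrix (Fin m) (Fin n) ℝ) (k : ℕ) : ℝ :=
  (Matrix.toEuclideanLin M).singularValues (k - 1)

/-- The Euclidean distance between the rows `u` and `v` of a matrix. -/
def rowDist {m n : ℕ} (M : Matrix (Fin m) (Fin n) ℝ) (u v : Fin m) : ℝ :=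
  √(∑ c, (M u c - M v c) ^ 2)

/-- The columns of `U` and `V` are the top `d` left and right singular vectors of `M`: the first
`d` columns of `U₀` and `V₀` in some singular value decomposition `M = U₀ diag(s) V₀ᵀ` with the
singular values `s` in decreasing order. -/
def IsTopSVD {N d : ℕ} (M : Matrix (Fin N) (Fin N) ℝ) (U V : Matrix (Fin N) (Fin d) ℝ) : Prop :=
  ∃ (h : d ≤ N) (U₀ V₀ : Matrix (Fin N) (Fin N) ℝ) (s : Fin N → ℝ),
    U₀ ∈ Matrix.orthogonalGroup (Fin N) ℝ ∧ V₀ ∈ Matrix.orthogonalGroup (Fin N) ℝ ∧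
    Antitone s ∧ (∀ i, 0 ≤ s i) ∧ M = U₀ * Matrix.diagonal s * V₀.transpose ∧
    U = U₀.submatrix id (Fin.castLE h) ∧ V = V₀.submatrix id (Fin.castLE h)

/-- The `k`-means cost `∑ᵤ ‖Wᵤ - ν (t u)‖²` of the centroids `ν` and the assignment `t`. -/
def kmeansCost {N K : ℕ} {ι : Type*} [Fintype ι] (W : Matrix (Fin N) ι ℝ)
    (ν : Matrix (Fin K) ι ℝ) (t : Fin N → Fin K) : ℝ :=
  ∑ u, ∑ c, (W u c - ν (t u) c) ^ 2

/-- `(ν, t)` minimises the `k`-means cost over all `K` centroids and all assignments. -/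
def IsKMeans {N K : ℕ} {ι : Type*} [Fintype ι] (W : Matrix (Fin N) ι ℝ)
    (ν : Matrix (Fin K) ι ℝ) (t : Fin N → Fin K) : Prop :=
  ∀ (ν' : Matrix (Fin K) ι ℝ) (t' : Fin N → Fin K), kmeansCost W ν t ≤ kmeansCost W ν' t'

/-- The number of misclustered nodes, minimised over the permutations of the labels. -/
def misclustered {N K : ℕ} (τ t : Fin N → Fin K) : ℕ :=
  Finset.univ.inf' Finset.univ_nonempty fun ρ : Equiv.Perm (Fin K) =>
    (Finset.univ.filter fun u => τ u ≠ ρ (t u)).card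

end DASE

end

/-!
The bound tends to 0, so for large `N` it asserts exact recovery: no node is misclustered.

Write `A = P + E`, where `P u v = B (τ u) (τ v)`. The only facts about the noise `E` that matter are
that `‖E‖` and the sums of `E` over the part of a row or column lying in one block are at most
`ε N`, for a small constant `ε` (`IsCloseToBlock`). Hoeffding's inequality gives both, because
`‖E‖⁴ ≤ ‖E Eᵀ‖_F²` and the inner products of distinct rows of `E` are sums of independent terms
(`eventually_isCloseToBlock`).

From `A² - P² = E P + E² + P E`, where `P = Z B Zᵀ` and `Z` is the block membership matrix, it
follows that every single row of `A² - P²` has norm `O(ε N √N)`, and `‖A² - P²‖ = O(ε N²)`. Let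
`U s Vᵀ` be a singular value decomposition of `A²`. By Weyl's inequalities the top `d` singular
values are of order `N²` and the others are `O(ε N²)`. As `U = A² V s⁻¹`, the rows of the top
columns of `U` are within `O(ε / √N)` of the rows of `P² V s⁻¹`, which are constant on blocks
(`IsSVD.row_sub_center_le`). These block centres are at distances of order `1 / √N` when the
corresponding rows of `B̃` differ, since a difference of rows of `P²` is almost contained in the
span of the top right singular vectors (`IsSVD.le_center_sub_center`). No comparison of singular
subspaces up to rotation is needed, and the same argument for `Aᵀ` treats the rows of `V`.

The separation of the rows of `B̃` is quantified through `B`, which does not depend on `N`: `B̃` has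
the range of `B`, so rows of `B̃` are separated on the scale `N` as soon as the rows of `B` are
distinct (`exists_separation`), and the separation of the rows of `ν̃` or `μ̃` forces any two blocks
to have different rows or different columns in `B` (`row_ne_or_column_ne`). Finally, rows
concentrated around separated centres are clustered without error by every minimiser of the
`k`-means cost (`IsKMeans.misclustered_eq_zero`).
-/

namespace DASE

open Filter Topology
open scoped Matrix.Norms.L2Operator

/-! ### Euclidean norms of vectors and matrices -/

/-- The Euclidean norm of a plain vector. -/
noncomputable def euclNorm {ι : Type*} [Fintype ι] (x : ι → ℝ) : ℝ := ‖WithLp.toLp 2 x‖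

section EuclNorm

variable {ι κ : Type*} [Fintype ι] [Fintype κ]

lemma euclNorm_nonneg (x : ι → ℝ) : 0 ≤ euclNorm x := norm_nonneg _

@[simp] lemma euclNorm_zero : euclNorm (0 : ι → ℝ) = 0 := by simp [euclNorm]

lemma euclNorm_sq (x : ι → ℝ) : euclNorm x ^ 2 = ∑ i, x i ^ 2 := by
  simp [euclNorm, EuclideanSpace.norm_sq_eq]

lemma euclNorm_sq_eq_dotProduct (x : ι → ℝ) : euclNorm x ^ 2 = x ⬝ᵥ x := by
  rw [euclNorm_sq]; exact Finset.sum_congr rfl fun i _ => by ring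

lemma euclNorm_pos_iff {x : ι → ℝ} : 0 < euclNorm x ↔ x ≠ 0 := by
  simp [euclNorm]

lemma euclNorm_add_le (x y : ι → ℝ) : euclNorm (x + y) ≤ euclNorm x + euclNorm y :=
  norm_add_le (WithLp.toLp 2 x) (WithLp.toLp 2 y)

lemma euclNorm_sub_le (x y : ι → ℝ) : euclNorm (x - y) ≤ euclNorm x + euclNorm y :=
  norm_sub_le (WithLp.toLp 2 x) (WithLp.toLp 2 y)

lemma euclNorm_sub_comm (x y : ι → ℝ) : euclNorm (x - y) = euclNorm (y - x) :=
  norm_sub_rev (WithLp.toLp 2 x) (WithLp.toLp 2 y)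

lemma euclNorm_sub_le_add (x y z : ι → ℝ) :
    euclNorm (x - z) ≤ euclNorm (x - y) + euclNorm (y - z) := by
  simpa using euclNorm_add_le (x - y) (y - z)

lemma dotProduct_le_euclNorm_mul (x y : ι → ℝ) : x ⬝ᵥ y ≤ euclNorm x * euclNorm y := by
  have h := real_inner_le_norm (WithLp.toLp 2 y) (WithLp.toLp 2 x)
  rw [EuclideanSpace.inner_eq_star_dotProduct] at h
  simpa [euclNorm, mul_comm] using h

lemma euclNorm_le_of_sq_le {x : ι → ℝ} {c : ℝ} (hc : 0 ≤ c) (h : ∑ i, x i ^ 2 ≤ c ^ 2) :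
    euclNorm x ≤ c :=
  le_of_sq_le_sq (by rwa [euclNorm_sq]) hc

/-- A vector with entries bounded by `c` has norm at most `c √n`. -/
lemma euclNorm_le_of_entries {x : ι → ℝ} {c : ℝ} (hc : 0 ≤ c) (h : ∀ i, |x i| ≤ c) :
    euclNorm x ≤ c * √(Fintype.card ι) := by
  refine euclNorm_le_of_sq_le (by positivity) ?_
  rw [mul_pow, Real.sq_sqrt (by positivity)]
  calc ∑ i, x i ^ 2 ≤ ∑ _i : ι, c ^ 2 :=
        Finset.sum_le_sum fun i _ => sq_le_sq' (abs_le.1 (h i)).1 (abs_le.1 (h i)).2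
    _ = c ^ 2 * Fintype.card ι := by simp [mul_comm]

lemma euclNorm_mulVec_le [DecidableEq κ] (M : Matrix ι κ ℝ) (x : κ → ℝ) :
    euclNorm (M.mulVec x) ≤ ‖M‖ * euclNorm x :=
  M.l2_opNorm_mulVec (WithLp.toLp 2 x)

lemma l2_opNorm_le_of_forall [DecidableEq κ] (M : Matrix ι κ ℝ) {c : ℝ} (hc : 0 ≤ c)
    (h : ∀ x, euclNorm (M.mulVec x) ≤ c * euclNorm x) : ‖M‖ ≤ c := by
  rw [Matrix.l2_opNorm_def]
  exact ContinuousLinearMap.opNorm_le_bound _ hc fun x => h x.ofLp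

lemma l2_opNorm_transpose [DecidableEq ι] [DecidableEq κ] (M : Matrix ι κ ℝ) :
    ‖M.transpose‖ = ‖M‖ := by
  rw [← Matrix.conjTranspose_eq_transpose_of_trivial, Matrix.l2_opNorm_conjTranspose]

/-- The operator norm is at most the Frobenius norm. -/
lemma l2_opNorm_le_frobenius [DecidableEq κ] (M : Matrix ι κ ℝ) :
    ‖M‖ ≤ √(∑ i, ∑ j, M i j ^ 2) := by
  refine l2_opNorm_le_of_forall M (Real.sqrt_nonneg _) fun x => ?_
  refine euclNorm_le_of_sq_le (mul_nonneg (Real.sqrt_nonneg _) (euclNorm_nonneg x)) ?_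
  rw [mul_pow, Real.sq_sqrt (by positivity), euclNorm_sq, Finset.sum_mul]
  exact Finset.sum_le_sum fun i _ => Finset.sum_mul_sq_le_sq_mul_sq _ _ _

lemma l2_opNorm_le_of_entries {N : ℕ} (M : Matrix (Fin N) (Fin N) ℝ)
    (h : ∀ i j, |M i j| ≤ 1) : ‖M‖ ≤ N := by
  refine (l2_opNorm_le_frobenius M).trans ?_
  rw [Real.sqrt_le_left (by positivity)]
  calc ∑ i, ∑ j, M i j ^ 2 ≤ ∑ _i : Fin N, ∑ _j : Fin N, (1 : ℝ) :=
        Finset.sum_le_sum fun i _ => Finset.sum_le_sum fun j _ => by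
          simpa using (sq_le_one_iff_abs_le_one _).2 (h i j)
    _ = (N : ℝ) ^ 2 := by simp [sq]

/-- The Gram matrix controls the operator norm: `‖M‖⁴ ≤ ‖M Mᵀ‖_F²`. -/
lemma l2_opNorm_pow_four_le [DecidableEq ι] [DecidableEq κ] (M : Matrix ι κ ℝ) :
    ‖M‖ ^ 4 ≤ ∑ i, ∑ j, (∑ k, M i k * M j k) ^ 2 := by
  have h1 : ‖M * M.transpose‖ = ‖M‖ * ‖M‖ := by
    have := Matrix.l2_opNorm_conjTranspose_mul_self M.transpose
    rwa [Matrix.conjTranspose_eq_transpose_of_trivial, Matrix.transpose_transpose,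
      l2_opNorm_transpose] at this
  have h2 := l2_opNorm_le_frobenius (M * M.transpose)
  rw [h1] at h2
  calc ‖M‖ ^ 4 = (‖M‖ * ‖M‖) ^ 2 := by ring
    _ ≤ (√(∑ i, ∑ j, (M * M.transpose) i j ^ 2)) ^ 2 := by gcongr
    _ = _ := by rw [Real.sq_sqrt (by positivity)]; simp [Matrix.mul_apply]

lemma dotProduct_mulVec_transpose (M : Matrix ι κ ℝ) (x : ι → ℝ) (y : κ → ℝ) :
    M.transpose.mulVec x ⬝ᵥ y = x ⬝ᵥ M.mulVec y := by
  rw [Matrix.mulVec_transpose, Matrix.dotProduct_mulVec]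

end EuclNorm

/-! ### Singular value decompositions under perturbation -/

section SVD

variable {N : ℕ} {M U V : Matrix (Fin N) (Fin N) ℝ} {s : Fin N → ℝ}

lemma orthogonal_transpose_mul (hU : U ∈ Matrix.orthogonalGroup (Fin N) ℝ) :
    U.transpose * U = 1 := (Matrix.mem_orthogonalGroup_iff' (Fin N) ℝ).1 hU

lemma orthogonal_mul_transpose (hU : U ∈ Matrix.orthogonalGroup (Fin N) ℝ) :
    U * U.transpose = 1 := (Matrix.mem_orthogonalGroup_iff (Fin N) ℝ).1 hU

lemma euclNorm_orthogonal_mulVec (hU : U ∈ Matrix.orthogonalGroup (Fin N) ℝ) (x : Fin N → ℝ) :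
    euclNorm (U.mulVec x) = euclNorm x := by
  have h : euclNorm (U.mulVec x) ^ 2 = euclNorm x ^ 2 := by
    rw [euclNorm_sq_eq_dotProduct, euclNorm_sq_eq_dotProduct, ← dotProduct_mulVec_transpose,
      Matrix.mulVec_mulVec, orthogonal_transpose_mul hU, Matrix.one_mulVec]
  exact (sq_eq_sq₀ (euclNorm_nonneg _) (euclNorm_nonneg _)).1 h

lemma euclNorm_orthogonal_transpose_mulVec (hU : U ∈ Matrix.orthogonalGroup (Fin N) ℝ)
    (x : Fin N → ℝ) : euclNorm (U.transpose.mulVec x) = euclNorm x := by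
  rw [← euclNorm_orthogonal_mulVec hU, Matrix.mulVec_mulVec, orthogonal_mul_transpose hU,
    Matrix.one_mulVec]

/-- `M = U diag(s) Vᵀ` is a singular value decomposition with decreasing singular values. -/
structure IsSVD (M U V : Matrix (Fin N) (Fin N) ℝ) (s : Fin N → ℝ) : Prop where
  left : U ∈ Matrix.orthogonalGroup (Fin N) ℝ
  right : V ∈ Matrix.orthogonalGroup (Fin N) ℝ
  anti : Antitone s
  nonneg : ∀ i, 0 ≤ s i
  eq : M = U * Matrix.diagonal s * V.transpose

lemma IsSVD.transpose (h : IsSVD M U V s) : IsSVD M.transpose V U s :=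
  ⟨h.right, h.left, h.anti, h.nonneg, by
    rw [h.eq]; simp [Matrix.transpose_mul, Matrix.mul_assoc]⟩

lemma IsSVD.mul_right (h : IsSVD M U V s) (u k : Fin N) : (M * V) u k = U u k * s k := by
  rw [h.eq, Matrix.mul_assoc, orthogonal_transpose_mul h.right, Matrix.mul_one,
    Matrix.mul_diagonal]

lemma IsSVD.euclNorm_mulVec_sq (h : IsSVD M U V s) (x : Fin N → ℝ) :
    euclNorm (M.mulVec x) ^ 2 = ∑ k, s k ^ 2 * V.transpose.mulVec x k ^ 2 := by
  rw [h.eq, Matrix.mul_assoc, ← Matrix.mulVec_mulVec, euclNorm_orthogonal_mulVec h.left,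
    ← Matrix.mulVec_mulVec, euclNorm_sq]
  exact Finset.sum_congr rfl fun k _ => by rw [Matrix.mulVec_diagonal, mul_pow]

/-- `M` does not stretch a vector by more than `s k` if its components along the right singular
vectors before the `k`-th vanish. -/
lemma IsSVD.euclNorm_mulVec_le (h : IsSVD M U V s) (k : Fin N) (x : Fin N → ℝ)
    (hx : ∀ l, l < k → V.transpose.mulVec x l = 0) :
    euclNorm (M.mulVec x) ≤ s k * euclNorm x := by
  refine le_of_sq_le_sq ?_ (mul_nonneg (h.nonneg k) (euclNorm_nonneg x))
  rw [h.euclNorm_mulVec_sq, mul_pow, ← euclNorm_orthogonal_transpose_mulVec h.right x, euclNorm_sq,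
    Finset.mul_sum]
  refine Finset.sum_le_sum fun l _ => ?_
  rcases lt_or_ge l k with hl | hl
  · simp [hx l hl]
  · have := h.anti hl
    have := h.nonneg l
    gcongr

/-- `M` stretches a vector by at least `s k` if its components along the right singular vectors
after the `k`-th vanish. -/
lemma IsSVD.le_euclNorm_mulVec (h : IsSVD M U V s) (k : Fin N) (x : Fin N → ℝ)
    (hx : ∀ l, k < l → V.transpose.mulVec x l = 0) :
    s k * euclNorm x ≤ euclNorm (M.mulVec x) := by
  refine le_of_sq_le_sq ?_ (euclNorm_nonneg _)
  rw [h.euclNorm_mulVec_sq, mul_pow, ← euclNorm_orthogonal_transpose_mulVec h.right x, euclNorm_sq,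
    Finset.mul_sum]
  refine Finset.sum_le_sum fun l _ => ?_
  rcases lt_or_ge k l with hl | hl
  · simp [hx l hl]
  · have := h.anti hl
    have := h.nonneg k
    gcongr

/-- A subspace whose dimension exceeds the number of linear conditions contains a nonzero vector
satisfying them. -/
lemma exists_ne_zero_mem_of_card_lt (S : Submodule ℝ (Fin N → ℝ)) (W : Matrix (Fin N) (Fin N) ℝ)
    (T : Finset (Fin N)) (hT : T.card < Module.finrank ℝ S) :
    ∃ x ∈ S, x ≠ 0 ∧ ∀ l ∈ T, W.mulVec x l = 0 := by
  let f : S →ₗ[ℝ] (T → ℝ) := (LinearMap.funLeft ℝ ℝ (Subtype.val : T → Fin N)) ∘ₗ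
    W.mulVecLin ∘ₗ S.subtype
  have hk : LinearMap.ker f ≠ ⊥ := LinearMap.ker_ne_bot_of_finrank_lt (by simpa using hT)
  obtain ⟨x, hx, hx0⟩ := Submodule.exists_mem_ne_zero_of_ne_bot hk
  refine ⟨x, x.2, by simpa using hx0, fun l hl => ?_⟩
  exact congrFun (LinearMap.mem_ker.1 hx) ⟨l, hl⟩

/-- Half of Weyl's inequality: a perturbation of a matrix of rank at most `d` has small singular
values from the `d`-th on (indexed from 0). -/
lemma IsSVD.singularValue_le (h : IsSVD M U V s) (M' : Matrix (Fin N) (Fin N) ℝ) {d : ℕ}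
    (hr : M'.rank ≤ d) (k : Fin N) (hk : d ≤ k) : s k ≤ ‖M - M'‖ := by
  have hdim : (Finset.Ioi k).card < Module.finrank ℝ (LinearMap.ker M'.mulVecLin) := by
    have h1 := M'.mulVecLin.finrank_range_add_finrank_ker
    have h2 : M'.rank = Module.finrank ℝ (LinearMap.range M'.mulVecLin) := rfl
    rw [Module.finrank_fin_fun] at h1
    rw [Fin.card_Ioi]
    have := k.2
    omega
  obtain ⟨x, hxS, hx0, hx⟩ := exists_ne_zero_mem_of_card_lt _ V.transpose _ hdim
  have h1 := h.le_euclNorm_mulVec k x fun l hl => hx l (Finset.mem_Ioi.2 hl)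
  have h2 : M.mulVec x = (M - M').mulVec x := by
    rw [Matrix.sub_mulVec]
    have : M'.mulVec x = 0 := hxS
    rw [this, sub_zero]
  rw [h2] at h1
  exact le_of_mul_le_mul_right (h1.trans (DASE.euclNorm_mulVec_le _ _)) (euclNorm_pos_iff.2 hx0)

/-- `M` stretches every vector of some subspace of dimension at least `d` by at least `c`. For
`d ≥ 1` and `c > 0` this says that the `d`-th largest singular value of `M` is at least `c`. -/
def StretchesSubspace {ι κ : Type*} [Fintype ι] [Fintype κ] (M : Matrix ι κ ℝ) (d : ℕ) (c : ℝ) :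
    Prop :=
  ∃ S : Submodule ℝ (κ → ℝ), d ≤ Module.finrank ℝ S ∧
    ∀ x ∈ S, c * euclNorm x ≤ euclNorm (M.mulVec x)

/-- The other half of Weyl's inequality: the first `d` singular values of a perturbation of a
matrix whose `d`-th largest singular value is at least `c`. -/
lemma IsSVD.le_singularValue (h : IsSVD M U V s) (M' : Matrix (Fin N) (Fin N) ℝ) {d : ℕ} {c : ℝ}
    (hS : StretchesSubspace M' d c) (k : Fin N) (hk : k < d) : c - ‖M - M'‖ ≤ s k := by
  obtain ⟨S, hd, hS⟩ := hS
  have hdim : (Finset.Iio k).card < Module.finrank ℝ S := by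
    rw [Fin.card_Iio]; omega
  obtain ⟨x, hxS, hx0, hx⟩ := exists_ne_zero_mem_of_card_lt _ V.transpose _ hdim
  have h1 := h.euclNorm_mulVec_le k x fun l hl => hx l (Finset.mem_Iio.2 hl)
  have h2 : M'.mulVec x = M.mulVec x - (M - M').mulVec x := by
    rw [Matrix.sub_mulVec]; abel
  have h3 := hS x hxS
  rw [h2] at h3
  have h4 := h3.trans (euclNorm_sub_le _ _)
  have h5 := DASE.euclNorm_mulVec_le (M - M') x
  refine le_of_mul_le_mul_right ?_ (euclNorm_pos_iff.2 hx0)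
  linarith

end SVD

/-! ### The doubled block matrix -/

section Stretch

variable {K d : ℕ}

/-- The right singular vectors for the `d` largest singular values span a subspace stretched by at
least the `d`-th largest singular value. -/
lemma stretchesSubspace_of_le_singularValue (M : Matrix (Fin K) (Fin K) ℝ) {c : ℝ} (hc : 0 < c)
    (h : c ≤ singularValue M d) : StretchesSubspace M d c := by
  -- for `d = 0` the truncated index `d - 1` is meaningless, but nothing is claimed
  rcases Nat.eq_zero_or_pos d with rfl | hd
  · refine ⟨⊥, Nat.zero_le _, fun x hx => ?_⟩
    rw [(Submodule.mem_bot ℝ).1 hx]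
    simp
  set T := Matrix.toEuclideanLin M with hT
  have hK : Module.finrank ℝ (EuclideanSpace ℝ (Fin K)) = K := finrank_euclideanSpace_fin
  have hdK : d ≤ K := by
    by_contra hlt
    have h0 : T.singularValues (d - 1) = 0 := T.singularValues_of_finrank_le (by omega)
    have h' : c ≤ T.singularValues (d - 1) := h
    linarith
  set hs := T.isSymmetric_adjoint_comp_self
  set b := hs.eigenvectorBasis hK
  set lam := hs.eigenvalues hK
  let v : Fin d → (Fin K → ℝ) := fun i => (b (Fin.castLE hdK i)).ofLp
  have hlam : ∀ i : Fin K, (i : ℕ) < d → c ^ 2 ≤ lam i := by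
    intro i hi
    have h1 : T.singularValues (d - 1) ≤ T.singularValues i :=
      T.singularValues_antitone (by omega)
    have h2 : T.singularValues i ^ 2 = lam i := T.sq_singularValues_fin hK i
    have h' : c ≤ T.singularValues (d - 1) := h
    rw [← h2]
    exact pow_le_pow_left₀ hc.le (h'.trans h1) 2
  have hv : LinearIndependent ℝ v := by
    have h1 : LinearIndependent ℝ fun i : Fin d => b (Fin.castLE hdK i) :=
      b.orthonormal.linearIndependent.comp _ (Fin.castLE_injective hdK)
    exact h1.map' (WithLp.linearEquiv 2 ℝ (Fin K → ℝ)).toLinearMap (LinearEquiv.ker _)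
  refine ⟨Submodule.span ℝ (Set.range v), ?_, fun x hx => ?_⟩
  · rw [finrank_span_eq_card hv, Fintype.card_fin]
  have hx0 : ∀ i : Fin K, d ≤ i → inner ℝ (b i) (WithLp.toLp 2 x) = 0 := by
    intro i hi
    induction hx using Submodule.span_induction with
    | mem x hx =>
      obtain ⟨l, rfl⟩ := hx
      have hne : i ≠ Fin.castLE hdK l := by
        intro h; have := congrArg Fin.val h; simp at this; omega
      exact b.orthonormal.2 hne
    | zero => simp
    | add x y _ _ hx hy => rw [WithLp.toLp_add, inner_add_right, hx, hy, add_zero]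
    | smul a x _ hx => rw [WithLp.toLp_smul, inner_smul_right, hx, mul_zero]
  set X : EuclideanSpace ℝ (Fin K) := WithLp.toLp 2 x with hX
  have key : ‖T X‖ ^ 2 = ∑ i, lam i * inner ℝ (b i) X ^ 2 := by
    have h1 : ‖T X‖ ^ 2 = inner ℝ X ((LinearMap.adjoint T ∘ₗ T) X) := by
      rw [LinearMap.comp_apply, LinearMap.adjoint_inner_right, real_inner_self_eq_norm_sq]
    rw [h1, ← b.sum_inner_mul_inner]
    refine Finset.sum_congr rfl fun i _ => ?_
    have h2 : inner ℝ (b i) ((LinearMap.adjoint T ∘ₗ T) X) = lam i * inner ℝ (b i) X := by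
      rw [← hs (b i) X, hs.apply_eigenvectorBasis hK i, inner_smul_left]
      simp [lam, b]
    rw [h2, real_inner_comm]; ring
  have hnorm : ‖X‖ ^ 2 = ∑ i, inner ℝ (b i) X ^ 2 := by
    rw [← b.sum_sq_norm_inner_right X]
    simp
  change c * ‖X‖ ≤ ‖T X‖
  refine le_of_sq_le_sq ?_ (norm_nonneg _)
  rw [mul_pow, key, hnorm, Finset.mul_sum]
  refine Finset.sum_le_sum fun i _ => ?_
  rcases lt_or_ge (i : ℕ) d with hi | hi
  · have := hlam i hi
    gcongr
  · simp [hx0 i hi]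

lemma injective_domRestrict_of_stretches {M : Matrix (Fin K) (Fin K) ℝ} {c : ℝ} (hc : 0 < c)
    {S : Submodule ℝ (Fin K → ℝ)} (hS : ∀ x ∈ S, c * euclNorm x ≤ euclNorm (M.mulVec x)) :
    Function.Injective (M.mulVecLin.domRestrict S) := by
  rw [← LinearMap.ker_eq_bot, LinearMap.ker_eq_bot']
  intro y hy
  have hy' : M.mulVec y.1 = 0 := hy
  have h1 := hS y.1 y.2
  rw [hy', euclNorm_zero] at h1
  by_contra hne
  have h2 : 0 < euclNorm y.1 := euclNorm_pos_iff.2 fun h => hne (Subtype.ext h)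
  exact absurd h1 (not_le.2 (mul_pos hc h2))

lemma range_domRestrict_le (M : Matrix (Fin K) (Fin K) ℝ) (S : Submodule ℝ (Fin K → ℝ)) :
    LinearMap.range (M.mulVecLin.domRestrict S) ≤ LinearMap.range M.mulVecLin := by
  rintro _ ⟨y, rfl⟩
  exact ⟨y.1, rfl⟩

lemma StretchesSubspace.le_rank {M : Matrix (Fin K) (Fin K) ℝ} {c : ℝ} (hc : 0 < c)
    (h : StretchesSubspace M d c) : d ≤ M.rank := by
  obtain ⟨S, hd, hS⟩ := h
  rw [← LinearMap.finrank_range_of_inj (injective_domRestrict_of_stretches hc hS)] at hd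
  exact hd.trans (Submodule.finrank_mono (range_domRestrict_le M S))

/-- If the rank of `M` is `d`, the subspace stretched by `M` maps onto the whole range. -/
lemma StretchesSubspace.exists_preimage {M : Matrix (Fin K) (Fin K) ℝ} {c : ℝ} (hc : 0 < c)
    (h : StretchesSubspace M d c) (hr : M.rank ≤ d) (x : Fin K → ℝ) :
    ∃ y, M.mulVec y = M.mulVec x ∧ c * euclNorm y ≤ euclNorm (M.mulVec x) := by
  obtain ⟨S, hd, hS⟩ := h
  have heq := Submodule.eq_of_le_of_finrank_le (range_domRestrict_le M S) (by
    rw [LinearMap.finrank_range_of_inj (injective_domRestrict_of_stretches hc hS)]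
    exact le_trans hr hd)
  have hx : M.mulVec x ∈ LinearMap.range (M.mulVecLin.domRestrict S) := by
    rw [heq]; exact ⟨x, rfl⟩
  obtain ⟨y, hy⟩ := hx
  have hy' : M.mulVec y.1 = M.mulVec x := hy
  exact ⟨y.1, hy', by rw [← hy']; exact hS y.1 y.2⟩

/-- A matrix of rank `d` and its transpose have the same `d`-th largest singular value. -/
lemma StretchesSubspace.transpose {M : Matrix (Fin K) (Fin K) ℝ} {c : ℝ} (hc : 0 < c)
    (h : StretchesSubspace M d c) (hr : M.rank ≤ d) : StretchesSubspace M.transpose d c := by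
  refine ⟨LinearMap.range M.mulVecLin, h.le_rank hc, ?_⟩
  rintro _ ⟨x, rfl⟩
  change c * euclNorm (M.mulVec x) ≤ _
  obtain ⟨y, hy, hyc⟩ := h.exists_preimage hc hr x
  rcases eq_or_ne (M.mulVec x) 0 with h0 | h0
  · rw [h0]
    simpa using euclNorm_nonneg _
  have hpos := euclNorm_pos_iff.2 h0
  have h1 : euclNorm (M.mulVec x) ^ 2 ≤
      euclNorm (M.transpose.mulVec (M.mulVec x)) * euclNorm y := by
    rw [euclNorm_sq_eq_dotProduct]
    nth_rewrite 2 [← hy]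
    rw [← dotProduct_mulVec_transpose]
    exact dotProduct_le_euclNorm_mul _ _
  refine le_of_mul_le_mul_right ?_ hpos
  calc c * euclNorm (M.mulVec x) * euclNorm (M.mulVec x)
      = c * euclNorm (M.mulVec x) ^ 2 := by ring
    _ ≤ c * (euclNorm (M.transpose.mulVec (M.mulVec x)) * euclNorm y) := by gcongr
    _ = euclNorm (M.transpose.mulVec (M.mulVec x)) * (c * euclNorm y) := by ring
    _ ≤ _ := by
      have := euclNorm_nonneg (M.transpose.mulVec (M.mulVec x))
      change _ ≤ euclNorm (M.transpose.mulVec (M.mulVec x)) * _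
      gcongr

end Stretch

section Block

variable {N K d : ℕ} {τ : Fin N → Fin K}

lemma sum_comp_block (τ : Fin N → Fin K) (f : Fin K → ℝ) :
    ∑ u, f (τ u) = ∑ i, (blockSize τ i : ℝ) * f i := by
  rw [← Finset.sum_fiberwise Finset.univ τ fun u => f (τ u)]
  refine Finset.sum_congr rfl fun i _ => ?_
  rw [Finset.sum_congr rfl fun u hu => by rw [(Finset.mem_filter.1 hu).2], Finset.sum_const,
    nsmul_eq_mul, blockSize]

lemma euclNorm_comp_block_sq (τ : Fin N → Fin K) (f : Fin K → ℝ) :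
    euclNorm (fun u => f (τ u)) ^ 2 = ∑ i, (blockSize τ i : ℝ) * f i ^ 2 := by
  rw [euclNorm_sq]; exact sum_comp_block τ fun i => f i ^ 2

lemma le_euclNorm_comp_block_sq {τ : Fin N → Fin K} {m : ℝ}
    (hm : ∀ i, m ≤ blockSize τ i) (f : Fin K → ℝ) :
    m * euclNorm f ^ 2 ≤ euclNorm (fun u => f (τ u)) ^ 2 := by
  rw [euclNorm_comp_block_sq τ, euclNorm_sq, Finset.mul_sum]
  exact Finset.sum_le_sum fun i _ => by have := hm i; gcongr

/-- The vector spreading the value `z i` evenly over the block `i`. -/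
noncomputable def spread (τ : Fin N → Fin K) (z : Fin K → ℝ) (u : Fin N) : ℝ :=
  z (τ u) / blockSize τ (τ u)

lemma blockSize_pos_of {m : ℝ} (hm0 : 0 < m) (hm : ∀ i, m ≤ blockSize τ i) (i : Fin K) :
    (0 : ℝ) < blockSize τ i := hm0.trans_le (hm i)

lemma submatrix_mulVec_spread {m : ℝ} (hm0 : 0 < m) (hm : ∀ i, m ≤ blockSize τ i)
    (M : Matrix (Fin K) (Fin K) ℝ) (z : Fin K → ℝ) :
    (M.submatrix τ τ).mulVec (spread τ z) = fun u => M.mulVec z (τ u) := by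
  ext u
  simp only [Matrix.mulVec, dotProduct, Matrix.submatrix_apply, spread]
  rw [sum_comp_block τ fun j => M (τ u) j * (z j / blockSize τ j)]
  refine Finset.sum_congr rfl fun j _ => ?_
  have := (blockSize_pos_of hm0 hm j).ne'
  field_simp

lemma mul_euclNorm_spread_sq_le {m : ℝ} (hm0 : 0 < m) (hm : ∀ i, m ≤ blockSize τ i)
    (z : Fin K → ℝ) : m * euclNorm (spread τ z) ^ 2 ≤ euclNorm z ^ 2 := by
  have h1 : euclNorm (spread τ z) ^ 2 = ∑ i, (blockSize τ i : ℝ) * (z i / blockSize τ i) ^ 2 :=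
    euclNorm_comp_block_sq τ fun i => z i / blockSize τ i
  rw [h1, euclNorm_sq, Finset.mul_sum]
  refine Finset.sum_le_sum fun i _ => ?_
  have hi := blockSize_pos_of hm0 hm i
  calc m * ((blockSize τ i : ℝ) * (z i / blockSize τ i) ^ 2)
      = z i ^ 2 * (m / blockSize τ i) := by field_simp
    _ ≤ z i ^ 2 * 1 := by
      gcongr
      exact (div_le_one hi).2 (hm i)
    _ = z i ^ 2 := mul_one _

lemma StretchesSubspace.submatrix {m c : ℝ} (hm0 : 0 < m) (hm : ∀ i, m ≤ blockSize τ i)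
    (hc : 0 ≤ c) {M : Matrix (Fin K) (Fin K) ℝ} (h : StretchesSubspace M d c) :
    StretchesSubspace (M.submatrix τ τ) d (m * c) := by
  obtain ⟨S, hd, hS⟩ := h
  let L : (Fin K → ℝ) →ₗ[ℝ] (Fin N → ℝ) :=
    { toFun := spread τ
      map_add' := fun x y => by ext u; simp [spread, add_div]
      map_smul' := fun a x => by ext u; simp [spread, mul_div_assoc] }
  have hL : Function.Injective L := by
    rw [← LinearMap.ker_eq_bot, LinearMap.ker_eq_bot']
    intro z hz
    ext i
    have hi := blockSize_pos_of hm0 hm i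
    have hne : (Finset.univ.filter fun u => τ u = i).Nonempty := by
      rw [← Finset.card_pos]; exact_mod_cast hi
    obtain ⟨u, hu⟩ := hne
    have h1 : z (τ u) / blockSize τ (τ u) = 0 := congrFun hz u
    rw [(Finset.mem_filter.1 hu).2] at h1
    simpa [hi.ne'] using h1
  refine ⟨S.map L, ?_, ?_⟩
  · rwa [(Submodule.equivMapOfInjective L hL S).finrank_eq.symm]
  · rintro _ ⟨z, hz, rfl⟩
    change m * c * euclNorm (spread τ z) ≤ euclNorm ((M.submatrix τ τ).mulVec (spread τ z))
    rw [submatrix_mulVec_spread hm0 hm]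
    refine le_of_sq_le_sq ?_ (euclNorm_nonneg _)
    calc (m * c * euclNorm (spread τ z)) ^ 2
        = m * c ^ 2 * (m * euclNorm (spread τ z) ^ 2) := by ring
      _ ≤ m * c ^ 2 * euclNorm z ^ 2 := by
        have := mul_euclNorm_spread_sq_le hm0 hm z
        gcongr
      _ = m * (c * euclNorm z) ^ 2 := by ring
      _ ≤ m * euclNorm (M.mulVec z) ^ 2 := by
        have := hS z hz
        have := euclNorm_nonneg z
        gcongr
      _ ≤ _ := le_euclNorm_comp_block_sq hm _

/-- Entrywise, `P²` is the doubled block matrix, where `P` is the block matrix with entries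
`B (τ u) (τ v)`, diagonal included. -/
lemma submatrix_mul_submatrix (B : Matrix (Fin K) (Fin K) ℝ) (τ : Fin N → Fin K) :
    B.submatrix τ τ * B.submatrix τ τ = (doubledBlockMatrix B τ).submatrix τ τ := by
  ext u v
  rw [Matrix.mul_apply, Matrix.submatrix_apply, doubledBlockMatrix, Matrix.mul_apply]
  simp only [Matrix.submatrix_apply, Matrix.mul_diagonal]
  rw [sum_comp_block τ fun j => B (τ u) j * B j (τ v)]
  exact Finset.sum_congr rfl fun j _ => by ring

lemma doubledBlockMatrix_transpose (B : Matrix (Fin K) (Fin K) ℝ) (τ : Fin N → Fin K) :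
    doubledBlockMatrix B.transpose τ = (doubledBlockMatrix B τ).transpose := by
  simp [doubledBlockMatrix, Matrix.transpose_mul, Matrix.mul_assoc]

lemma rank_doubledBlockMatrix_le (B : Matrix (Fin K) (Fin K) ℝ) (τ : Fin N → Fin K) :
    (doubledBlockMatrix B τ).rank ≤ B.rank := by
  rw [doubledBlockMatrix]
  exact Matrix.rank_mul_le_right _ _

lemma rank_submatrix_doubledBlockMatrix_le (B : Matrix (Fin K) (Fin K) ℝ) (τ : Fin N → Fin K) :
    ((doubledBlockMatrix B τ).submatrix τ τ).rank ≤ B.rank := by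
  have h : (doubledBlockMatrix B τ).submatrix τ τ =
      (1 : Matrix (Fin K) (Fin K) ℝ).submatrix τ id * doubledBlockMatrix B τ *
        (1 : Matrix (Fin K) (Fin K) ℝ).submatrix id τ := by
    ext u v
    simp [Matrix.mul_apply, Matrix.one_apply]
  rw [h]
  exact (Matrix.rank_mul_le_left _ _).trans
    ((Matrix.rank_mul_le_right _ _).trans (rank_doubledBlockMatrix_le B τ))

/-- Rows of `B̃` are separated by at least the separation of the rows of `B`, up to constants.
Since `B̃` has the same range as `B`, there is a vector `y` of norm at most `‖B Bᵀ v‖ / c` with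
`B̃ y = B Bᵀ v`; pairing `B̃ᵀ v` with `y` gives `‖Bᵀ v‖²`. -/
lemma le_euclNorm_doubledBlockMatrix_transpose_mulVec {B : Matrix (Fin K) (Fin K) ℝ}
    (hB : ∀ i j, 0 ≤ B i j ∧ B i j ≤ 1) {c : ℝ} (hc : 0 < c)
    (h : StretchesSubspace (doubledBlockMatrix B τ) B.rank c) (v : Fin K → ℝ) :
    c * euclNorm (B.transpose.mulVec v) ≤
      K * euclNorm ((doubledBlockMatrix B τ).transpose.mulVec v) := by
  set M := doubledBlockMatrix B τ with hM
  have hle : LinearMap.range M.mulVecLin ≤ LinearMap.range B.mulVecLin := by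
    rintro _ ⟨y, rfl⟩
    refine ⟨(Matrix.diagonal (fun i => (blockSize τ i : ℝ)) * B).mulVec y, ?_⟩
    simp [hM, doubledBlockMatrix, Matrix.mulVec_mulVec, Matrix.mul_assoc]
  have heq := Submodule.eq_of_le_of_finrank_le hle (h.le_rank hc)
  have hx : B.mulVec (B.transpose.mulVec v) ∈ LinearMap.range M.mulVecLin := by
    rw [heq]; exact ⟨_, rfl⟩
  obtain ⟨x, hx⟩ := hx
  have hx' : M.mulVec x = B.mulVec (B.transpose.mulVec v) := hx
  obtain ⟨y, hy, hyc⟩ := h.exists_preimage hc (rank_doubledBlockMatrix_le B τ) x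
  rw [hx'] at hy hyc
  have hBK : ‖B‖ ≤ K := l2_opNorm_le_of_entries B fun i j =>
    abs_le.2 ⟨by linarith [(hB i j).1], (hB i j).2⟩
  set p := euclNorm (B.transpose.mulVec v) with hp
  set q := euclNorm (M.transpose.mulVec v) with hq
  have hq0 : 0 ≤ q := euclNorm_nonneg _
  have hp0 : 0 ≤ p := euclNorm_nonneg _
  have h1 : p ^ 2 ≤ q * euclNorm y := by
    rw [hp, euclNorm_sq_eq_dotProduct, dotProduct_mulVec_transpose, ← hy,
      ← dotProduct_mulVec_transpose]
    exact dotProduct_le_euclNorm_mul _ _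
  have h2 : c * euclNorm y ≤ K * p := by
    refine hyc.trans ((euclNorm_mulVec_le _ _).trans ?_)
    gcongr
  rcases hp0.eq_or_lt with h0 | h0
  · rw [← h0, mul_zero]; positivity
  refine le_of_mul_le_mul_right ?_ h0
  calc c * p * p = c * p ^ 2 := by ring
    _ ≤ c * (q * euclNorm y) := by gcongr
    _ = q * (c * euclNorm y) := by ring
    _ ≤ q * (K * p) := by gcongr
    _ = K * q * p := by ring

end Block

/-! ### Squares of matrices close to a block matrix -/

/-- `A` is an `ε`-approximation of the block matrix `P` with entries `B (τ u) (τ v)`: relative to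
the trivial bound `N`, both the operator norm of `A - P` and the sums of `A - P` over the part of a
row that belongs to one block are small. -/
structure IsCloseToBlock {N K : ℕ} (B : Matrix (Fin K) (Fin K) ℝ) (τ : Fin N → Fin K)
    (A : Matrix (Fin N) (Fin N) ℝ) (ε : ℝ) : Prop where
  entry : ∀ u v, 0 ≤ A u v ∧ A u v ≤ 1
  norm_le : ‖A - B.submatrix τ τ‖ ≤ ε * N
  block_sum_le : ∀ u j, |∑ v with τ v = j, (A u v - B (τ u) j)| ≤ ε * N

section Close

variable {N K d : ℕ} {τ : Fin N → Fin K} {B : Matrix (Fin K) (Fin K) ℝ}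
  {A : Matrix (Fin N) (Fin N) ℝ} {ε : ℝ}

lemma row_mul (M M' : Matrix (Fin N) (Fin N) ℝ) (u : Fin N) :
    (M * M') u = M'.transpose.mulVec (M u) := by
  ext v
  rw [Matrix.mulVec_transpose]; rfl

lemma euclNorm_row_mul_le (M M' : Matrix (Fin N) (Fin N) ℝ) (u : Fin N) :
    euclNorm ((M * M') u) ≤ ‖M'‖ * euclNorm (M u) := by
  rw [row_mul, ← l2_opNorm_transpose M']
  exact euclNorm_mulVec_le _ _

lemma sq_sub_sq_eq (A P : Matrix (Fin N) (Fin N) ℝ) :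
    A * A - P * P = (A - P) * P + (A - P) * (A - P) + P * (A - P) := by
  noncomm_ring

lemma IsCloseToBlock.norm_sq_sub_le (h : IsCloseToBlock B τ A ε)
    (hB : ∀ i j, 0 ≤ B i j ∧ B i j ≤ 1) :
    ‖A * A - B.submatrix τ τ * B.submatrix τ τ‖ ≤ 2 * ε * N ^ 2 := by
  set P := B.submatrix τ τ with hP
  have h1 : ‖A‖ ≤ N := l2_opNorm_le_of_entries A fun i j =>
    abs_le.2 ⟨by linarith [(h.entry i j).1], (h.entry i j).2⟩
  have h2 : ‖P‖ ≤ N := l2_opNorm_le_of_entries P fun i j =>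
    abs_le.2 ⟨by linarith [(hB (τ i) (τ j)).1, show P i j = B (τ i) (τ j) from rfl],
      (hB (τ i) (τ j)).2⟩
  have h3 := h.norm_le
  have h4 : A * A - P * P = (A - P) * A + P * (A - P) := by noncomm_ring
  rw [h4]
  have hE := norm_nonneg (A - P)
  have hεN : 0 ≤ ε * N := hE.trans h3
  calc ‖(A - P) * A + P * (A - P)‖ ≤ ‖A - P‖ * ‖A‖ + ‖P‖ * ‖A - P‖ :=
        (norm_add_le _ _).trans (add_le_add (norm_mul_le _ _) (norm_mul_le _ _))
    _ ≤ (ε * N) * N + N * (ε * N) := by gcongr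
    _ = 2 * ε * N ^ 2 := by ring

/-- Every row of `A² - P²` is short, compared with the trivial bound `N √N`. With `E = A - P`, the
row of `A² - P²` is the sum of the rows of `E P`, `E²` and `P E`; the first consists of
combinations of block sums of a row of `E`, the other two are controlled by `‖E‖`. -/
lemma IsCloseToBlock.euclNorm_row_sq_sub_le (h : IsCloseToBlock B τ A ε)
    (hB : ∀ i j, 0 ≤ B i j ∧ B i j ≤ 1) (u : Fin N) :
    euclNorm ((A * A - B.submatrix τ τ * B.submatrix τ τ) u) ≤ (K + 2) * ε * N * √N := by
  set P := B.submatrix τ τ with hP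
  have hεN : 0 ≤ ε * N := (norm_nonneg _).trans h.norm_le
  have hEentry : ∀ u v, |(A - P) u v| ≤ 1 := fun u v => by
    have h1 := h.entry u v
    have h2 := hB (τ u) (τ v)
    rw [Matrix.sub_apply, hP, Matrix.submatrix_apply, abs_le]
    constructor <;> linarith
  have hErow : euclNorm ((A - P) u) ≤ √N := by
    simpa using euclNorm_le_of_entries zero_le_one (hEentry u)
  have hProw : euclNorm (P u) ≤ √N := by
    have : ∀ v, |P u v| ≤ 1 := fun v =>
      abs_le.2 ⟨by linarith [(hB (τ u) (τ v)).1, show P u v = B (τ u) (τ v) from rfl],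
        (hB (τ u) (τ v)).2⟩
    simpa using euclNorm_le_of_entries zero_le_one this
  have h1 : euclNorm (((A - P) * P) u) ≤ K * (ε * N) * √N := by
    have hentry : ∀ w, |((A - P) * P) u w| ≤ K * (ε * N) := by
      intro w
      have heq : ((A - P) * P) u w =
          ∑ j, (∑ v with τ v = j, (A u v - B (τ u) j)) * B j (τ w) := by
        rw [Matrix.mul_apply, ← Finset.sum_fiberwise Finset.univ τ]
        refine Finset.sum_congr rfl fun j _ => ?_
        rw [Finset.sum_mul]
        refine Finset.sum_congr rfl fun v hv => ?_
        rw [← (Finset.mem_filter.1 hv).2]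
        rfl
      rw [heq]
      calc |∑ j, (∑ v with τ v = j, (A u v - B (τ u) j)) * B j (τ w)|
          ≤ ∑ j, |(∑ v with τ v = j, (A u v - B (τ u) j)) * B j (τ w)| :=
            Finset.abs_sum_le_sum_abs _ _
        _ ≤ ∑ _j : Fin K, ε * N := by
            refine Finset.sum_le_sum fun j _ => ?_
            rw [abs_mul, abs_of_nonneg (hB j (τ w)).1]
            have := h.block_sum_le u j
            have := (hB j (τ w)).1
            calc _ ≤ (ε * N) * 1 := by
                  gcongr
                  exact (hB j (τ w)).2
              _ = ε * N := mul_one _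
        _ = K * (ε * N) := by simp
    simpa using euclNorm_le_of_entries (by positivity) hentry
  have h2 : euclNorm (((A - P) * (A - P)) u) ≤ (ε * N) * √N := by
    refine (euclNorm_row_mul_le _ _ _).trans ?_
    have := h.norm_le
    have := euclNorm_nonneg ((A - P) u)
    gcongr
  have h3 : euclNorm ((P * (A - P)) u) ≤ (ε * N) * √N := by
    refine (euclNorm_row_mul_le _ _ _).trans ?_
    have := h.norm_le
    have := euclNorm_nonneg (P u)
    gcongr
  rw [sq_sub_sq_eq]
  have h4 := euclNorm_add_le (((A - P) * P + (A - P) * (A - P)) u) ((P * (A - P)) u)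
  have h5 := euclNorm_add_le (((A - P) * P) u) (((A - P) * (A - P)) u)
  change euclNorm (((A - P) * P + (A - P) * (A - P)) u + (P * (A - P)) u) ≤ _
  change euclNorm (((A - P) * P + (A - P) * (A - P)) u) ≤ _ at h5
  linarith

end Close

/-! ### Rows of the top singular vectors -/

lemma sum_castLE {N d : ℕ} (hdN : d ≤ N) (f : Fin N → ℝ) :
    ∑ k, f (Fin.castLE hdN k) = ∑ k : Fin N, if (k : ℕ) < d then f k else 0 := by
  rw [← Finset.sum_filter]
  refine Finset.sum_bij (fun k _ => Fin.castLE hdN k) (fun k _ => by simp)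
    (fun a _ b _ hab => Fin.castLE_injective hdN hab) (fun k hk => ?_) (fun _ _ => rfl)
  exact ⟨⟨k, (Finset.mem_filter.1 hk).2⟩, Finset.mem_univ _, rfl⟩

section Rows

variable {N K d : ℕ} {τ : Fin N → Fin K} {Bt : Matrix (Fin K) (Fin K) ℝ}
  {M U V : Matrix (Fin N) (Fin N) ℝ} {s : Fin N → ℝ}

/-- If `Q` has rank at most `d`, any combination `x = Qᵀ y` of the rows of `Q` is nearly contained
in the span of the top `d` right singular vectors of a perturbation `M` of `Q`: its component `q`
orthogonal to that span satisfies `‖q‖² = ⟨y, Q q⟩`, and both `M` and `M - Q` shrink `q`. -/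
lemma IsSVD.tail_le (h : IsSVD M U V s) (Q : Matrix (Fin N) (Fin N) ℝ) (hr : Q.rank ≤ d)
    (y : Fin N → ℝ) :
    ∑ k : Fin N, (if (k : ℕ) < d then 0 else V.transpose.mulVec (Q.transpose.mulVec y) k ^ 2) ≤
      (2 * ‖M - Q‖ * euclNorm y) ^ 2 := by
  set x := Q.transpose.mulVec y with hx
  let p : Fin N → ℝ := fun k => if (k : ℕ) < d then 0 else V.transpose.mulVec x k
  set q := V.mulVec p with hq
  have hVq : V.transpose.mulVec q = p := by
    rw [hq, Matrix.mulVec_mulVec, orthogonal_transpose_mul h.right, Matrix.one_mulVec]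
  have hqp : euclNorm q = euclNorm p := euclNorm_orthogonal_mulVec h.right p
  have hsum : ∑ k : Fin N, (if (k : ℕ) < d then 0 else V.transpose.mulVec x k ^ 2) =
      euclNorm q ^ 2 := by
    rw [hqp, euclNorm_sq]
    refine Finset.sum_congr rfl fun k _ => ?_
    simp only [p]
    split_ifs <;> simp
  have hMq : euclNorm (M.mulVec q) ≤ ‖M - Q‖ * euclNorm q := by
    rcases lt_or_ge d N with hd | hd
    · refine (h.euclNorm_mulVec_le ⟨d, hd⟩ q fun l hl => ?_).trans ?_
      · rw [hVq]
        exact if_pos hl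
      · have := h.singularValue_le Q hr ⟨d, hd⟩ le_rfl
        have := euclNorm_nonneg q
        gcongr
    · have hp0 : p = 0 := by
        ext k
        exact if_pos (k.2.trans_le hd)
      rw [hq, hp0]
      simp
  have hQq : euclNorm (Q.mulVec q) ≤ 2 * ‖M - Q‖ * euclNorm q := by
    have h1 : Q.mulVec q = M.mulVec q - (M - Q).mulVec q := by
      rw [Matrix.sub_mulVec]; abel
    rw [h1]
    have h2 := euclNorm_sub_le (M.mulVec q) ((M - Q).mulVec q)
    have h3 := DASE.euclNorm_mulVec_le (M - Q) q
    linarith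
  have hdot : euclNorm q ^ 2 = y ⬝ᵥ Q.mulVec q := by
    rw [hqp, euclNorm_sq]
    have h1 : y ⬝ᵥ Q.mulVec q = V.transpose.mulVec x ⬝ᵥ p := by
      rw [dotProduct_mulVec_transpose, hx, dotProduct_mulVec_transpose]
    rw [h1]
    refine Finset.sum_congr rfl fun k _ => ?_
    simp only [p]
    split_ifs
    · simp
    · ring
  have hle : euclNorm q ^ 2 ≤ euclNorm y * (2 * ‖M - Q‖ * euclNorm q) := by
    rw [hdot]
    refine (dotProduct_le_euclNorm_mul _ _).trans ?_
    have := euclNorm_nonneg y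
    gcongr
  have hq0 := euclNorm_nonneg q
  have hfin : euclNorm q ≤ 2 * ‖M - Q‖ * euclNorm y := by
    rcases hq0.eq_or_lt with h0 | h0
    · rw [← h0]
      have := euclNorm_nonneg y
      positivity
    · refine le_of_mul_le_mul_right ?_ h0
      linarith
  rw [hsum]
  gcongr

/-- The centre to which the rows of the left singular vectors in a block are close. -/
noncomputable def center (Bt : Matrix (Fin K) (Fin K) ℝ) (τ : Fin N → Fin K)
    (V : Matrix (Fin N) (Fin N) ℝ) (s : Fin N → ℝ) (hdN : d ≤ N) : Matrix (Fin K) (Fin d) ℝ :=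
  fun i k => V.transpose.mulVec (fun w => Bt i (τ w)) (Fin.castLE hdN k) / s (Fin.castLE hdN k)

/-- Since `U s = M V`, the rows of `U` are as close to the centres `Q V s⁻¹` as the rows of `M` are
to those of `Q`, up to the factor `s⁻¹`; here `Q` is constant on blocks. -/
lemma IsSVD.row_sub_center_le (h : IsSVD M U V s) (hdN : d ≤ N) {c r : ℝ} (hc : 0 < c)
    (hs : ∀ k : Fin N, (k : ℕ) < d → c ≤ s k) (u : Fin N)
    (hr : euclNorm ((M - Bt.submatrix τ τ) u) ≤ r) :
    ∑ k, (U u (Fin.castLE hdN k) - center Bt τ V s hdN (τ u) k) ^ 2 ≤ (r / c) ^ 2 := by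
  set R := (M - Bt.submatrix τ τ) u with hR
  have hterm : ∀ k : Fin d, (U u (Fin.castLE hdN k) - center Bt τ V s hdN (τ u) k) ^ 2 ≤
      V.transpose.mulVec R (Fin.castLE hdN k) ^ 2 / c ^ 2 := by
    intro k
    have hsk := hs (Fin.castLE hdN k) (by simp)
    have hpos : 0 < s (Fin.castLE hdN k) := hc.trans_le hsk
    have h1 : U u (Fin.castLE hdN k) * s (Fin.castLE hdN k) =
        V.transpose.mulVec (M u) (Fin.castLE hdN k) := by
      rw [← h.mul_right, row_mul]
    have h2 : R = M u - fun w => Bt (τ u) (τ w) := rfl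
    have h3 : U u (Fin.castLE hdN k) - center Bt τ V s hdN (τ u) k =
        V.transpose.mulVec R (Fin.castLE hdN k) / s (Fin.castLE hdN k) := by
      rw [h2, Matrix.mulVec_sub, Pi.sub_apply, ← h1, center]
      field_simp
    rw [h3, div_pow]
    gcongr
  calc _ ≤ ∑ k : Fin d, V.transpose.mulVec R (Fin.castLE hdN k) ^ 2 / c ^ 2 :=
        Finset.sum_le_sum fun k _ => hterm k
    _ = (∑ k : Fin N, if (k : ℕ) < d then V.transpose.mulVec R k ^ 2 else 0) / c ^ 2 := by
        rw [← Finset.sum_div, sum_castLE hdN fun k => V.transpose.mulVec R k ^ 2]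
    _ ≤ (∑ k, V.transpose.mulVec R k ^ 2) / c ^ 2 := by
        gcongr with k
        split_ifs
        · exact le_rfl
        · positivity
    _ = euclNorm R ^ 2 / c ^ 2 := by
        rw [← euclNorm_sq, euclNorm_orthogonal_transpose_mulVec h.right]
    _ ≤ r ^ 2 / c ^ 2 := by
        have := euclNorm_nonneg R
        gcongr
    _ = (r / c) ^ 2 := (div_pow _ _ _).symm

/-- The centres of two blocks are separated if the corresponding rows of `B̃` are. -/
lemma IsSVD.le_center_sub_center (h : IsSVD M U V s) (hdN : d ≤ N) {m t : ℝ} (hm0 : 0 < m)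
    (hm : ∀ i, m ≤ blockSize τ i) (hs : ∀ k : Fin N, (k : ℕ) < d → 0 < s k)
    (ht : ∀ k, s k ≤ t) (hr : (Bt.submatrix τ τ).rank ≤ d) (i j : Fin K) :
    (m * euclNorm (fun l => Bt i l - Bt j l) ^ 2 -
        (4 * ‖M - Bt.submatrix τ τ‖) ^ 2 / m) / t ^ 2 ≤
      ∑ k, (center Bt τ V s hdN i k - center Bt τ V s hdN j k) ^ 2 := by
  set Q := Bt.submatrix τ τ with hQ
  set z : Fin K → ℝ := Pi.single i 1 - Pi.single j 1 with hz
  set x : Fin N → ℝ := fun w => Bt i (τ w) - Bt j (τ w) with hx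
  have hxQ : Q.transpose.mulVec (spread τ z) = x := by
    have h1 : Q.transpose = Bt.transpose.submatrix τ τ := rfl
    rw [h1, submatrix_mulVec_spread hm0 hm]
    ext w
    simp [hz, hx, Matrix.mulVec_sub]
  have htail := h.tail_le Q hr (spread τ z)
  rw [hxQ] at htail
  have hz2 : euclNorm z ^ 2 ≤ 4 := by
    have h1 : ∀ a : Fin K, euclNorm (Pi.single a (1 : ℝ)) = 1 := fun a => by
      simp [euclNorm]
    have h2 := euclNorm_sub_le (Pi.single i (1 : ℝ)) (Pi.single j (1 : ℝ))
    rw [h1, h1] at h2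
    have h3 := euclNorm_nonneg z
    nlinarith
  have hspread := mul_euclNorm_spread_sq_le hm0 hm z
  have htail' : (2 * ‖M - Q‖ * euclNorm (spread τ z)) ^ 2 ≤ (4 * ‖M - Q‖) ^ 2 / m := by
    rw [le_div_iff₀ hm0]
    calc _ = (2 * ‖M - Q‖) ^ 2 * (m * euclNorm (spread τ z) ^ 2) := by ring
      _ ≤ (2 * ‖M - Q‖) ^ 2 * 4 := by gcongr; linarith
      _ = _ := by ring
  have hhead : m * euclNorm (fun l => Bt i l - Bt j l) ^ 2 - (4 * ‖M - Q‖) ^ 2 / m ≤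
      ∑ k : Fin N, if (k : ℕ) < d then V.transpose.mulVec x k ^ 2 else 0 := by
    have h1 : (∑ k : Fin N, if (k : ℕ) < d then V.transpose.mulVec x k ^ 2 else 0) +
        (∑ k : Fin N, if (k : ℕ) < d then 0 else V.transpose.mulVec x k ^ 2) = euclNorm x ^ 2 := by
      rw [← Finset.sum_add_distrib, ← euclNorm_orthogonal_transpose_mulVec h.right x, euclNorm_sq]
      refine Finset.sum_congr rfl fun k _ => ?_
      split_ifs <;> simp
    have h2 := le_euclNorm_comp_block_sq hm fun l => Bt i l - Bt j l
    change _ ≤ euclNorm x ^ 2 at h2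
    linarith
  have hterm : ∀ k : Fin d, V.transpose.mulVec x (Fin.castLE hdN k) ^ 2 / t ^ 2 ≤
      (center Bt τ V s hdN i k - center Bt τ V s hdN j k) ^ 2 := by
    intro k
    have hpos := hs (Fin.castLE hdN k) (by simp)
    have htk := ht (Fin.castLE hdN k)
    have h2 : x = (fun w => Bt i (τ w)) - fun w => Bt j (τ w) := rfl
    rw [center, center, ← sub_div, ← Pi.sub_apply, ← Matrix.mulVec_sub, ← h2, div_pow]
    gcongr
  calc _ ≤ (∑ k : Fin N, if (k : ℕ) < d then V.transpose.mulVec x k ^ 2 else 0) / t ^ 2 := by gcongr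
    _ = ∑ k : Fin d, V.transpose.mulVec x (Fin.castLE hdN k) ^ 2 / t ^ 2 := by
        rw [← Finset.sum_div, sum_castLE hdN fun k => V.transpose.mulVec x k ^ 2]
    _ ≤ _ := Finset.sum_le_sum fun k _ => hterm k

end Rows

section TopRows

variable {N K : ℕ} {τ : Fin N → Fin K} {B : Matrix (Fin K) (Fin K) ℝ}
  {A U V : Matrix (Fin N) (Fin N) ℝ} {s : Fin N → ℝ} {ε : ℝ}

/-- If `A` is close to a block matrix, the rows of the top left singular vectors of `A²` are within
`O(ε / √N)` of centres attached to the blocks, while the centres of blocks with distinct rows in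
`B̃` are at distance of order `1 / √N`. -/
theorem exists_centers_of_isCloseToBlock (hN : 0 < N) (hB : ∀ i j, 0 ≤ B i j ∧ B i j ≤ 1)
    {πt bt : ℝ} (hπ : 0 < πt) (hb : 0 < bt) (hτ : ∀ i, πt * N ≤ blockSize τ i)
    (hS : StretchesSubspace (doubledBlockMatrix B τ) B.rank (bt * N))
    (hA : IsCloseToBlock B τ A ε) (hε : ε ≤ πt * bt / 4) (h : IsSVD (A * A) U V s)
    (hdN : B.rank ≤ N) :
    ∃ C : Matrix (Fin K) (Fin B.rank) ℝ,
      (∀ u, ∑ k, (U u (Fin.castLE hdN k) - C (τ u) k) ^ 2 ≤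
        (2 * (K + 2) * ε / (πt * bt)) ^ 2 / N) ∧
      ∀ i j β, 0 ≤ β → β * N ≤ euclNorm (fun l => doubledBlockMatrix B τ i l -
          doubledBlockMatrix B τ j l) →
        (πt * β ^ 2 - 64 * ε ^ 2 / πt) / N ≤ ∑ k, (C i k - C j k) ^ 2 := by
  have hN' : (0 : ℝ) < N := by exact_mod_cast hN
  set Q := (doubledBlockMatrix B τ).submatrix τ τ with hQ
  have hΔ : ‖A * A - Q‖ ≤ 2 * ε * N ^ 2 := by
    have := hA.norm_sq_sub_le hB
    rwa [submatrix_mul_submatrix] at this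
  have hrow : ∀ u, euclNorm ((A * A - Q) u) ≤ (K + 2) * ε * N * √N := by
    intro u
    have := hA.euclNorm_row_sq_sub_le hB u
    rwa [submatrix_mul_submatrix] at this
  have hm0 : 0 < πt * N := by positivity
  have hlow : ∀ k : Fin N, (k : ℕ) < B.rank → πt * bt * N ^ 2 / 2 ≤ s k := by
    intro k hk
    have h1 := h.le_singularValue Q (hS.submatrix hm0 hτ (by positivity)) k hk
    have h2 : 2 * ε * (N : ℝ) ^ 2 ≤ 2 * (πt * bt / 4) * N ^ 2 := by gcongr
    nlinarith
  have hup : ∀ k, s k ≤ (N : ℝ) ^ 2 := by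
    intro k
    have h1 := h.singularValue_le 0 (d := 0) (by simp) k (Nat.zero_le _)
    rw [sub_zero] at h1
    have h2 : ‖A‖ ≤ N := l2_opNorm_le_of_entries A fun i j =>
      abs_le.2 ⟨by linarith [(hA.entry i j).1], (hA.entry i j).2⟩
    calc s k ≤ ‖A‖ * ‖A‖ := h1.trans (norm_mul_le _ _)
      _ ≤ N * N := by gcongr
      _ = (N : ℝ) ^ 2 := by ring
  have hc : 0 < πt * bt * N ^ 2 / 2 := by positivity
  refine ⟨center (doubledBlockMatrix B τ) τ V s hdN, fun u => ?_, fun i j β hβ hij => ?_⟩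
  · refine (h.row_sub_center_le hdN hc hlow u (hrow u)).trans (le_of_eq ?_)
    have h1 : ((K + 2) * ε * N * √N / (πt * bt * N ^ 2 / 2)) ^ 2 =
        (2 * (K + 2) * ε / (πt * bt)) ^ 2 * (√N) ^ 2 / N ^ 2 := by
      field_simp
    rw [h1, Real.sq_sqrt hN'.le]
    field_simp
  · refine le_trans ?_ (h.le_center_sub_center hdN hm0 hτ (fun k hk => hc.trans_le (hlow k hk)) hup
      (rank_submatrix_doubledBlockMatrix_le B τ) i j)
    have h1 : (πt * β ^ 2 - 64 * ε ^ 2 / πt) / N =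
        (πt * N * (β * N) ^ 2 - (4 * (2 * ε * N ^ 2)) ^ 2 / (πt * N)) / ((N : ℝ) ^ 2) ^ 2 := by
      field_simp
      ring
    rw [h1]
    gcongr

end TopRows

/-! ### Exact recovery by `k`-means -/

section KMeans

variable {N K : ℕ} {ι : Type*} [Fintype ι]

lemma kmeansCost_eq (W : Matrix (Fin N) ι ℝ) (ν : Matrix (Fin K) ι ℝ) (t : Fin N → Fin K) :
    kmeansCost W ν t = ∑ u, euclNorm (W u - ν (t u)) ^ 2 :=
  Finset.sum_congr rfl fun u _ => by rw [euclNorm_sq]; rfl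

/-- In an optimal clustering every point belongs to a nearest centroid. -/
lemma IsKMeans.euclNorm_le {W : Matrix (Fin N) ι ℝ} {ν : Matrix (Fin K) ι ℝ} {t : Fin N → Fin K}
    (h : IsKMeans W ν t) (u : Fin N) (j : Fin K) :
    euclNorm (W u - ν (t u)) ≤ euclNorm (W u - ν j) := by
  refine le_of_sq_le_sq ?_ (euclNorm_nonneg _)
  have h1 := h ν (Function.update t u j)
  rw [kmeansCost_eq, kmeansCost_eq, ← Finset.add_sum_erase _ _ (Finset.mem_univ u),
    ← Finset.add_sum_erase _ _ (Finset.mem_univ u)] at h1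
  have h2 : ∑ v ∈ Finset.univ.erase u, euclNorm (W v - ν (Function.update t u j v)) ^ 2 =
      ∑ v ∈ Finset.univ.erase u, euclNorm (W v - ν (t v)) ^ 2 :=
    Finset.sum_congr rfl fun v hv => by
      rw [Function.update_of_ne (Finset.ne_of_mem_erase hv)]
  rw [h2, Function.update_self] at h1
  linarith

/-- If the points of each block lie within `δ` of the centre of the block, the centres are `4 r`
apart, and leaving out a whole block would be too expensive, every optimal clustering recovers the
blocks exactly. -/
theorem IsKMeans.misclustered_eq_zero {W : Matrix (Fin N) ι ℝ} {ν : Matrix (Fin K) ι ℝ}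
    {t : Fin N → Fin K} (h : IsKMeans W ν t) {τ : Fin N → Fin K} (C : Matrix (Fin K) ι ℝ)
    {δ r m : ℝ} (hδ0 : 0 ≤ δ) (hδr : δ < r) (hm : ∀ i, m ≤ blockSize τ i)
    (hclose : ∀ u, euclNorm (W u - C (τ u)) ≤ δ)
    (hsep : ∀ i j, i ≠ j → 4 * r ≤ euclNorm (C i - C j))
    (hcost : N * δ ^ 2 < m * (r - δ) ^ 2) : misclustered τ t = 0 := by
  have hupper : kmeansCost W ν t ≤ N * δ ^ 2 := by
    refine (h C τ).trans ?_
    rw [kmeansCost_eq]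
    calc ∑ u, euclNorm (W u - C (τ u)) ^ 2 ≤ ∑ _u : Fin N, δ ^ 2 :=
          Finset.sum_le_sum fun u _ => pow_le_pow_left₀ (euclNorm_nonneg _) (hclose u) 2
      _ = N * δ ^ 2 := by simp
  have hnear : ∀ i, ∃ j, euclNorm (ν j - C i) < r := by
    intro i
    by_contra! hfar
    refine absurd hupper (not_le.2 (hcost.trans_le ?_))
    rw [kmeansCost_eq]
    calc m * (r - δ) ^ 2 ≤ blockSize τ i * (r - δ) ^ 2 := by
          gcongr
          exact hm i
      _ = ∑ u with τ u = i, (r - δ) ^ 2 := by simp [blockSize]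
      _ ≤ ∑ u with τ u = i, euclNorm (W u - ν (t u)) ^ 2 := by
          refine Finset.sum_le_sum fun u hu => ?_
          have h1 := hfar (t u)
          have h2 := hclose u
          rw [(Finset.mem_filter.1 hu).2] at h2
          have h3 := euclNorm_sub_le_add (ν (t u)) (W u) (C i)
          rw [euclNorm_sub_comm (ν (t u)) (W u)] at h3
          exact pow_le_pow_left₀ (by linarith) (by linarith) 2
      _ ≤ ∑ u, euclNorm (W u - ν (t u)) ^ 2 :=
          Finset.sum_le_sum_of_subset_of_nonneg (Finset.filter_subset _ _)
            fun u _ _ => sq_nonneg _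
  choose f hf using hnear
  have hinj : Function.Injective f := by
    intro i j hij
    by_contra hne
    have h1 := hsep i j hne
    have h2 := euclNorm_sub_le_add (C i) (ν (f i)) (C j)
    have h3 := hf i
    have h4 := hf j
    rw [euclNorm_sub_comm] at h3
    rw [← hij] at h4
    linarith
  have hbij : Function.Bijective f := Finite.injective_iff_bijective.1 hinj
  have ht : ∀ u, t u = f (τ u) := by
    intro u
    obtain ⟨i, hi⟩ := hbij.2 (t u)
    by_cases hiu : i = τ u
    · rw [← hi, hiu]
    exfalso
    have h1 := h.euclNorm_le u (f (τ u))
    rw [← hi] at h1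
    have h2 := hsep (τ u) i (Ne.symm hiu)
    have h3 := hclose u
    have h4 := hf i
    have h5 := hf (τ u)
    have h6 := euclNorm_sub_le_add (W u) (C (τ u)) (ν (f (τ u)))
    rw [euclNorm_sub_comm (C (τ u)) (ν (f (τ u)))] at h6
    have h7 := euclNorm_sub_le_add (C (τ u)) (W u) (C i)
    have h8 := euclNorm_sub_le_add (W u) (ν (f i)) (C i)
    rw [euclNorm_sub_comm (C (τ u)) (W u)] at h7
    linarith
  refine Nat.le_zero.1 (le_trans (Finset.inf'_le _
    (Finset.mem_univ (Equiv.ofBijective f hbij).symm)) (le_of_eq ?_))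
  rw [Finset.card_eq_zero, Finset.filter_eq_empty_iff]
  intro u _
  rw [not_not, ht u]
  exact ((Equiv.ofBijective f hbij).symm_apply_apply (τ u)).symm

end KMeans

/-! ### Exact recovery from a matrix close to a block matrix -/

lemma exists_pos_le_of_pos {ι : Type*} [Finite ι] (f : ι → ℝ) :
    ∃ γ > 0, ∀ i, 0 < f i → γ ≤ f i := by
  have h : ∀ᶠ γ in 𝓝[>] (0 : ℝ), ∀ i, 0 < f i → γ ≤ f i := by
    rw [eventually_all]
    intro i
    by_cases hi : 0 < f i
    · filter_upwards [nhdsWithin_le_nhds (eventually_le_nhds hi)] with γ hγ _ using hγ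
    · exact Eventually.of_forall fun γ h => absurd h hi
  obtain ⟨γ, h1, h2⟩ := (h.and self_mem_nhdsWithin).exists
  exact ⟨γ, h2, h1⟩

/-- Distinct rows of `B` stay separated, on the scale `N`, in `B̃`. -/
lemma exists_separation {K : ℕ} {B : Matrix (Fin K) (Fin K) ℝ}
    (hB : ∀ i j, 0 ≤ B i j ∧ B i j ≤ 1) {bt : ℝ} (hb : 0 < bt) :
    ∃ β > 0, ∀ (N : ℕ) (τ : Fin N → Fin K), 0 < N →
      StretchesSubspace (doubledBlockMatrix B τ) B.rank (bt * N) →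
      ∀ i j, B i ≠ B j → β * N ≤ euclNorm (fun l => doubledBlockMatrix B τ i l -
          doubledBlockMatrix B τ j l) := by
  obtain ⟨γ, hγ, hγB⟩ := exists_pos_le_of_pos fun p : Fin K × Fin K => euclNorm (B p.1 - B p.2)
  refine ⟨bt * γ / (K + 1), by positivity, fun N τ hN hS i j hij => ?_⟩
  have hN' : (0 : ℝ) < N := by exact_mod_cast hN
  have h1 := hγB (i, j) (euclNorm_pos_iff.2 (sub_ne_zero.2 hij))
  have h2 := le_euclNorm_doubledBlockMatrix_transpose_mulVec hB (by positivity) hS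
    (Pi.single i 1 - Pi.single j 1)
  have hrow : ∀ M : Matrix (Fin K) (Fin K) ℝ,
      M.transpose.mulVec (Pi.single i 1 - Pi.single j 1) = fun l => M i l - M j l := by
    intro M
    ext l
    simp [Matrix.mulVec_sub]
  rw [hrow, hrow] at h2
  change bt * N * euclNorm (B i - B j) ≤ _ at h2
  set q := euclNorm fun l => doubledBlockMatrix B τ i l - doubledBlockMatrix B τ j l
  have hq : 0 ≤ q := euclNorm_nonneg _
  have h3 : bt * N * γ ≤ (K + 1) * q := by
    have : bt * N * γ ≤ bt * N * euclNorm (B i - B j) := by gcongr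
    linarith
  rw [div_mul_eq_mul_div, div_le_iff₀ (by positivity)]
  linarith

lemma euclNorm_fromCols_sq {N d : ℕ} (U V : Matrix (Fin N) (Fin d) ℝ) (u : Fin N)
    {K : ℕ} (C D : Matrix (Fin K) (Fin d) ℝ) (i : Fin K) :
    euclNorm (Matrix.fromCols U V u - Matrix.fromCols C D i) ^ 2 =
      ∑ k, (U u k - C i k) ^ 2 + ∑ k, (V u k - D i k) ^ 2 := by
  rw [euclNorm_sq, Fintype.sum_sum_type]
  rfl

/-- Deterministic part of the argument: for small `ε`, if `A` and its transpose are `ε`-close to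
the block matrix and its transpose, clustering the top singular vectors of `A²` recovers the blocks
exactly. -/
theorem exists_misclustered_eq_zero {K : ℕ} {B : Matrix (Fin K) (Fin K) ℝ}
    (hB : ∀ i j, 0 ≤ B i j ∧ B i j ≤ 1) {πt bt : ℝ} (hπ : 0 < πt) (hb : 0 < bt) :
    ∃ ε > 0, ∀ (N : ℕ) (τ : Fin N → Fin K), 0 < N → (∀ i, πt * N ≤ blockSize τ i) →
      bt * N ≤ singularValue (doubledBlockMatrix B τ) B.rank →
      (∀ i j, i ≠ j → B i ≠ B j ∨ B.transpose i ≠ B.transpose j) →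
      ∀ A : Matrix (Fin N) (Fin N) ℝ, IsCloseToBlock B τ A ε →
        IsCloseToBlock B.transpose τ A.transpose ε →
      ∀ U V : Matrix (Fin N) (Fin B.rank) ℝ, IsTopSVD (A * A) U V →
      ∀ (ν : Matrix (Fin K) (Fin B.rank ⊕ Fin B.rank) ℝ) (t : Fin N → Fin K),
        IsKMeans (Matrix.fromCols U V) ν t → misclustered τ t = 0 := by
  have hBT : ∀ i j, 0 ≤ B.transpose i j ∧ B.transpose i j ≤ 1 := fun i j => hB j i
  obtain ⟨β₁, hβ₁, hsep₁⟩ := exists_separation hB hb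
  obtain ⟨β₂, hβ₂, hsep₂⟩ := exists_separation hBT hb
  set β := min β₁ β₂ with hβdef
  have hβ : 0 < β := lt_min hβ₁ hβ₂
  set a : ℝ := 2 * (K + 2) / (πt * bt) with ha
  have ha0 : 0 < a := by positivity
  -- on the scale `1 / √N`, rows are within `2 a ε` of the centres, which are `4 ρ` apart
  set ρ : ℝ := √(πt * β ^ 2 / 2) / 4 with hρ
  have hρ0 : 0 < ρ := by positivity
  have hεs : ∀ᶠ ε in 𝓝[>] (0 : ℝ), ε < πt * bt / 4 ∧ 64 * ε ^ 2 / πt < πt * β ^ 2 / 2 ∧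
      2 * a * ε < ρ ∧ (2 * a * ε) ^ 2 < πt * (ρ - 2 * a * ε) ^ 2 := by
    refine Filter.Eventually.filter_mono nhdsWithin_le_nhds ?_
    have lt_near : ∀ f g : ℝ → ℝ, Continuous f → Continuous g → f 0 < g 0 →
        ∀ᶠ ε in 𝓝 (0 : ℝ), f ε < g ε := fun f g hf hg h =>
      hf.continuousAt.eventually_lt hg.continuousAt h
    refine (lt_near _ _ continuous_id continuous_const (by simp; positivity)).and
      ((lt_near _ _ (by fun_prop) continuous_const (by simp; positivity)).and
      ((lt_near _ _ (by fun_prop) continuous_const (by simpa using hρ0)).and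
      (lt_near _ _ (by fun_prop) (by fun_prop) (by simp; positivity))))
  obtain ⟨ε, ⟨hε1, hε2, hε3, hε4⟩, hε0⟩ := (hεs.and self_mem_nhdsWithin).exists
  have hε0 : 0 < ε := hε0
  refine ⟨ε, hε0, fun N τ hN hτ hsv hdist A hA hAT U V hUV ν t hkm => ?_⟩
  have hN' : (0 : ℝ) < N := by exact_mod_cast hN
  obtain ⟨hdN, U₀, V₀, s, hU₀, hV₀, hs, hs0, hAA, rfl, rfl⟩ := hUV
  have hsvd : IsSVD (A * A) U₀ V₀ s := ⟨hU₀, hV₀, hs, hs0, hAA⟩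
  have hsvdT : IsSVD (A.transpose * A.transpose) V₀ U₀ s := by
    rw [← Matrix.transpose_mul]; exact hsvd.transpose
  have hS : StretchesSubspace (doubledBlockMatrix B τ) B.rank (bt * N) :=
    stretchesSubspace_of_le_singularValue _ (by positivity) hsv
  have hST : StretchesSubspace (doubledBlockMatrix B.transpose τ) B.rank (bt * N) := by
    rw [doubledBlockMatrix_transpose]
    exact hS.transpose (by positivity) (rank_doubledBlockMatrix_le B τ)
  have hrank : B.transpose.rank = B.rank := B.rank_transpose
  obtain ⟨C, hC, hCsep⟩ := exists_centers_of_isCloseToBlock hN hB hπ hb hτ hS hA hε1.le hsvd hdN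
  obtain ⟨D, hD, hDsep⟩ : ∃ D : Matrix (Fin K) (Fin B.rank) ℝ,
      (∀ u, ∑ k, (V₀ u (Fin.castLE hdN k) - D (τ u) k) ^ 2 ≤
        (2 * (K + 2) * ε / (πt * bt)) ^ 2 / N) ∧
      ∀ i j β, 0 ≤ β → β * N ≤ euclNorm (fun l => doubledBlockMatrix B.transpose τ i l -
          doubledBlockMatrix B.transpose τ j l) →
        (πt * β ^ 2 - 64 * ε ^ 2 / πt) / N ≤ ∑ k, (D i k - D j k) ^ 2 := by
    have := exists_centers_of_isCloseToBlock hN hBT hπ hb hτ (by rw [hrank]; exact hST) hAT hε1.le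
      hsvdT (by rw [hrank]; exact hdN)
    revert this
    -- the index type `Fin Bᵀ.rank` has to be identified with `Fin B.rank`
    generalize_proofs h1
    revert h1
    rw [hrank]
    exact fun _ h => h
  have hae : 2 * (K + 2) * ε / (πt * bt) = a * ε := by rw [ha]; ring
  rw [hae] at hC hD
  have hsqrt : 0 < √(N : ℝ) := Real.sqrt_pos.2 hN'
  have hsep : ∀ i j, i ≠ j → 4 * (ρ / √N) ≤
      euclNorm (Matrix.fromCols C D i - Matrix.fromCols C D j) := by
    intro i j hij
    refine le_of_sq_le_sq ?_ (euclNorm_nonneg _)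
    rw [euclNorm_fromCols_sq]
    have h1 : (4 * (ρ / √N)) ^ 2 ≤ (πt * β ^ 2 - 64 * ε ^ 2 / πt) / N := by
      rw [hρ, show 4 * (√(πt * β ^ 2 / 2) / 4 / √N) = √(πt * β ^ 2 / 2) / √N by ring, div_pow,
        Real.sq_sqrt (by positivity), Real.sq_sqrt hN'.le]
      gcongr
      linarith
    have hC0 : 0 ≤ ∑ k, (C i k - C j k) ^ 2 := Finset.sum_nonneg fun k _ => sq_nonneg _
    have hD0 : 0 ≤ ∑ k, (D i k - D j k) ^ 2 := Finset.sum_nonneg fun k _ => sq_nonneg _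
    rcases hdist i j hij with h2 | h2
    · have h3 := hCsep i j β hβ.le (le_trans (by gcongr; exact min_le_left _ _)
        (hsep₁ N τ hN hS i j h2))
      linarith
    · have h3 := hDsep i j β hβ.le (le_trans (by gcongr; exact min_le_right _ _)
        (hsep₂ N τ hN (by rw [hrank]; exact hST) i j h2))
      linarith
  refine hkm.misclustered_eq_zero (Matrix.fromCols C D) (δ := 2 * a * ε / √N) (r := ρ / √N)
    (m := πt * N) (by positivity) (by gcongr) hτ (fun u => ?_) hsep ?_
  · refine le_of_sq_le_sq ?_ (by positivity)
    rw [euclNorm_fromCols_sq, div_pow, Real.sq_sqrt hN'.le]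
    have h1 := hC u
    have h2 := hD u
    have h3 : (2 * a * ε) ^ 2 / N = 4 * ((a * ε) ^ 2 / N) := by ring
    have h4 : 0 ≤ (a * ε) ^ 2 / N := by positivity
    rw [h3]
    simp only [Matrix.submatrix_apply, id]
    linarith
  · rw [← sub_div, div_pow, div_pow, Real.sq_sqrt hN'.le]
    field_simp
    linarith [hε4]

/-! ### Concentration of the noise -/

/-- The noise of an adjacency matrix: the deviation from the block probabilities off the diagonal,
and 0 on the diagonal, where the adjacency matrix is deterministic. -/
noncomputable def noise {N K : ℕ} (B : Matrix (Fin K) (Fin K) ℝ) (τ : Fin N → Fin K)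
    (A : Matrix (Fin N) (Fin N) ℝ) : Matrix (Fin N) (Fin N) ℝ :=
  fun i j => if i = j then 0 else A i j - B (τ i) (τ j)

section Noise

variable {N K : ℕ} {B : Matrix (Fin K) (Fin K) ℝ} {τ : Fin N → Fin K}
  {A : Matrix (Fin N) (Fin N) ℝ}

lemma noise_transpose : noise B.transpose τ A.transpose = (noise B τ A).transpose := by
  ext i j
  simp [noise, eq_comm]

lemma abs_noise_le (hB : ∀ i j, 0 ≤ B i j ∧ B i j ≤ 1) (hA : ∀ i j, A i j = 0 ∨ A i j = 1)
    (i j : Fin N) : |noise B τ A i j| ≤ 1 := by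
  have h1 := hB (τ i) (τ j)
  rw [noise]
  split_ifs
  · simp
  · rcases hA i j with h | h <;> rw [h, abs_le] <;> constructor <;> linarith

/-- Replacing `A - P` by the noise changes only the diagonal, by entries of size at most 1. -/
lemma isCloseToBlock_of_noise {ε : ℝ} (hB : ∀ i j, 0 ≤ B i j ∧ B i j ≤ 1)
    (hA : ∀ i j, A i j = 0 ∨ A i j = 1) (hdiag : ∀ i, A i i = 0) (hN : 1 ≤ ε / 2 * N)
    (hnorm : ‖noise B τ A‖ ≤ ε / 2 * N)
    (hsum : ∀ u j, |∑ v with τ v = j, noise B τ A u v| ≤ ε / 2 * N) :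
    IsCloseToBlock B τ A ε := by
  have hentry : ∀ u v, A u v - B (τ u) (τ v) =
      noise B τ A u v - if u = v then B (τ u) (τ v) else 0 := by
    intro u v
    rw [noise]
    split_ifs with h
    · rw [← h, hdiag]
    · simp
  refine ⟨fun u v => by rcases hA u v with h | h <;> simp [h], ?_, fun u j => ?_⟩
  · have h1 : A - B.submatrix τ τ =
        noise B τ A - Matrix.diagonal fun u => B (τ u) (τ u) := by
      ext u v
      rw [Matrix.sub_apply, Matrix.submatrix_apply, hentry, Matrix.sub_apply,
        Matrix.diagonal_apply]
      split_ifs with h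
      · rw [h]
      · rfl
    have h2 : ‖(Matrix.diagonal fun u => B (τ u) (τ u) : Matrix (Fin N) (Fin N) ℝ)‖ ≤ 1 := by
      rw [Matrix.l2_opNorm_diagonal, pi_norm_le_iff_of_nonneg zero_le_one]
      intro u
      rw [Real.norm_eq_abs, abs_of_nonneg (hB _ _).1]
      exact (hB _ _).2
    rw [h1]
    have h3 := norm_sub_le (noise B τ A) (Matrix.diagonal fun u => B (τ u) (τ u))
    linarith
  · have h1 : ∑ v with τ v = j, (A u v - B (τ u) j) = ∑ v with τ v = j, noise B τ A u v -
        ∑ v with τ v = j, if u = v then B (τ u) (τ v) else 0 := by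
      rw [← Finset.sum_sub_distrib]
      refine Finset.sum_congr rfl fun v hv => ?_
      rw [← hentry, (Finset.mem_filter.1 hv).2]
    have h2 : |∑ v with τ v = j, if u = v then B (τ u) (τ v) else 0| ≤ 1 := by
      rw [Finset.sum_ite_eq]
      split_ifs
      · rw [abs_of_nonneg (hB _ _).1]
        exact (hB _ _).2
      · simp
    rw [h1]
    have h3 := abs_sub (∑ v with τ v = j, noise B τ A u v)
      (∑ v with τ v = j, if u = v then B (τ u) (τ v) else 0)
    have h4 := hsum u j
    linarith

/-- If distinct rows of the noise are nearly orthogonal, its operator norm is small. -/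
lemma norm_noise_le {ε η : ℝ} (hB : ∀ i j, 0 ≤ B i j ∧ B i j ≤ 1)
    (hA : ∀ i j, A i j = 0 ∨ A i j = 1) (hε : 0 ≤ ε) (hηε : 2 * η ^ 2 ≤ ε ^ 4)
    (hN : 1 ≤ η ^ 2 * N)
    (h : ∀ u v, u ≠ v → |∑ w, noise B τ A u w * noise B τ A v w| ≤ η * N) :
    ‖noise B τ A‖ ≤ ε * N := by
  have hterm : ∀ u v, (∑ w, noise B τ A u w * noise B τ A v w) ^ 2 ≤
      (if u = v then (N : ℝ) ^ 2 else 0) + (η * N) ^ 2 := by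
    intro u v
    split_ifs with huv
    · have h1 : |∑ w, noise B τ A u w * noise B τ A v w| ≤ N := by
        calc _ ≤ ∑ w, |noise B τ A u w * noise B τ A v w| := Finset.abs_sum_le_sum_abs _ _
          _ ≤ ∑ _w : Fin N, (1 : ℝ) := by
              refine Finset.sum_le_sum fun w _ => ?_
              rw [abs_mul]
              exact mul_le_one₀ (abs_noise_le hB hA u w) (abs_nonneg _) (abs_noise_le hB hA v w)
          _ = N := by simp
      have h2 := sq_le_sq' (abs_le.1 h1).1 (abs_le.1 h1).2
      have h3 := sq_nonneg (η * N)
      linarith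
    · have h1 := h u v huv
      rw [zero_add]
      exact sq_le_sq' (abs_le.1 h1).1 (abs_le.1 h1).2
  have h1 : ‖noise B τ A‖ ^ 4 ≤ (ε * N) ^ 4 := by
    calc ‖noise B τ A‖ ^ 4 ≤ ∑ u, ∑ v, (∑ w, noise B τ A u w * noise B τ A v w) ^ 2 :=
          l2_opNorm_pow_four_le _
      _ ≤ ∑ u : Fin N, ∑ v : Fin N, ((if u = v then (N : ℝ) ^ 2 else 0) + (η * N) ^ 2) :=
          Finset.sum_le_sum fun u _ => Finset.sum_le_sum fun v _ => hterm u v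
      _ = (N : ℝ) ^ 3 * 1 + η ^ 2 * N ^ 4 := by
          simp [Finset.sum_add_distrib]
          ring
      _ ≤ (N : ℝ) ^ 3 * (η ^ 2 * N) + η ^ 2 * N ^ 4 := by gcongr
      _ = (2 * η ^ 2) * N ^ 4 := by ring
      _ ≤ ε ^ 4 * N ^ 4 := by gcongr
      _ = (ε * N) ^ 4 := by ring
  exact le_of_pow_le_pow_left₀ (by norm_num) (by positivity) h1

end Noise

section Subgaussian

variable {Ω : Type*} [MeasurableSpace Ω] {μ : Measure Ω}

lemma hasSubgaussianMGF_mono {X : Ω → ℝ} {c c' : NNReal} (h : HasSubgaussianMGF X c μ)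
    (hc : c ≤ c') : HasSubgaussianMGF X c' μ := by
  refine ⟨h.integrable_exp_mul, fun t => (h.mgf_le t).trans (Real.exp_le_exp.2 ?_)⟩
  have : (c : ℝ) ≤ c' := hc
  gcongr

lemma measureReal_abs_gt_le {X : Ω → ℝ} {n : ℕ} [IsProbabilityMeasure μ]
    (h : HasSubgaussianMGF X n μ) {t : ℝ} (ht : 0 ≤ t) :
    μ.real {ω | t < |X ω|} ≤ 2 * Real.exp (-t ^ 2 / (2 * n)) := by
  have h1 := h.measure_ge_le ht
  have h2 := h.neg.measure_ge_le ht
  have h3 : {ω | t < |X ω|} ⊆ {ω | t ≤ X ω} ∪ {ω | t ≤ (-X) ω} := by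
    intro ω hω
    rcases lt_abs.1 (show t < |X ω| from hω) with h | h
    · exact Or.inl h.le
    · exact Or.inr h.le
  have h4 := (measureReal_mono h3).trans (measureReal_union_le (μ := μ) _ _)
  simp only [NNReal.coe_natCast] at h1 h2
  linarith

/-- Adjoining constants to an independent family keeps it independent. -/
lemma iIndepFun_of_subtype [IsProbabilityMeasure μ] {ι : Type*} {p : ι → Prop} {f : ι → Ω → ℝ}
    (h : iIndepFun (fun (i : {i // p i}) => f i) μ) {c : ι → ℝ}
    (hc : ∀ i, ¬ p i → ∀ ω, f i ω = c i) : iIndepFun f μ := by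
  classical
  rw [iIndepFun_iff_measure_inter_preimage_eq_mul] at h ⊢
  intro S sets hs
  by_cases hex : ∃ a ∈ S, ¬ p a ∧ c a ∉ sets a
  · obtain ⟨a, haS, hpa, hca⟩ := hex
    have hempty : f a ⁻¹' sets a = ∅ := by
      ext ω
      simp [hc a hpa ω, hca]
    rw [Finset.prod_eq_zero haS (by rw [hempty, measure_empty])]
    refine measure_mono_null (t := f a ⁻¹' sets a) (Set.biInter_subset_of_mem haS) ?_
    rw [hempty, measure_empty]
  · push Not at hex
    have huniv : ∀ a ∈ S, ¬ p a → f a ⁻¹' sets a = Set.univ := by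
      intro a ha hpa
      ext ω
      simp [hc a hpa ω, hex a ha hpa]
    have hprod : ∏ i ∈ S, μ (f i ⁻¹' sets i) =
        ∏ i ∈ S.subtype p, μ (f i ⁻¹' sets i) := by
      rw [Finset.prod_subtype_eq_prod_filter (s := S) (p := p)
        (fun i => μ (f i ⁻¹' sets i)), Finset.prod_filter]
      refine Finset.prod_congr rfl fun a ha => ?_
      split_ifs with hpa
      · rfl
      · rw [huniv a ha hpa, measure_univ]
    have hinter : ⋂ i ∈ S, f i ⁻¹' sets i = ⋂ i ∈ S.subtype p, f i ⁻¹' sets i := by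
      ext ω
      simp only [Set.mem_iInter, Finset.mem_subtype]
      refine ⟨fun h i hi => h i hi, fun h i hi => ?_⟩
      by_cases hpi : p i
      · exact h ⟨i, hpi⟩ hi
      · rw [huniv i hi hpi]; trivial
    rw [hprod, hinter]
    exact h (S.subtype p) (sets := fun i => sets i) fun i hi => hs i (Finset.mem_subtype.1 hi)

/-- A product of independent centred variables with values in `[-1, 1]` is sub-Gaussian, with
parameter 1. -/
lemma hasSubgaussianMGF_mul [IsProbabilityMeasure μ] {X Y : Ω → ℝ} (hX : Measurable X)
    (hY : Measurable Y) (hX1 : ∀ ω, |X ω| ≤ 1) (hY1 : ∀ ω, |Y ω| ≤ 1) (h : IndepFun X Y μ)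
    (hX0 : ∫ ω, X ω ∂μ = 0) : HasSubgaussianMGF (fun ω => X ω * Y ω) 1 μ := by
  have h1 : ∀ ω, X ω * Y ω ∈ Set.Icc (-1 : ℝ) 1 := fun ω => by
    rw [Set.mem_Icc, ← abs_le, abs_mul]
    exact mul_le_one₀ (hX1 ω) (abs_nonneg _) (hY1 ω)
  have h2 := hasSubgaussianMGF_of_mem_Icc_of_integral_eq_zero (μ := μ)
    (hX.mul hY).aemeasurable (Filter.Eventually.of_forall h1)
    (by rw [Pi.mul_def, h.integral_fun_mul_eq_mul_integral hX.aestronglyMeasurable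
      hY.aestronglyMeasurable, hX0, zero_mul])
  refine hasSubgaussianMGF_mono h2 (le_of_eq ?_)
  rw [← NNReal.coe_inj]
  norm_num

end Subgaussian

section SBM

variable {N K : ℕ} {B : Matrix (Fin K) (Fin K) ℝ} {τ : Fin N → Fin K}
  {Ω : Type*} [MeasurableSpace Ω] {μ : Measure Ω} {A : Ω → Matrix (Fin N) (Fin N) ℝ}

lemma IsDirectedSBM.measurable_noise (h : IsDirectedSBM B τ μ A) (i j : Fin N) :
    Measurable fun ω => noise B τ (A ω) i j := by
  unfold noise
  split_ifs
  · exact measurable_const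
  · exact (h.measurable_entry i j).sub_const _

lemma IsDirectedSBM.iIndepFun_noise [IsProbabilityMeasure μ] (h : IsDirectedSBM B τ μ A) :
    iIndepFun (fun (p : Fin N × Fin N) ω => noise B τ (A ω) p.1 p.2) μ := by
  refine iIndepFun_of_subtype (p := fun p => p.1 ≠ p.2) (c := fun _ => 0) ?_ ?_
  · have h1 := h.indep.comp (fun p x => x - B (τ p.1.1) (τ p.1.2))
      fun p => measurable_id.sub_const _
    convert! h1 using 3 with p ω
    simp [noise, p.2]
  · intro p hp ω
    simp [noise, not_not.1 hp]

lemma IsDirectedSBM.integral_noise [IsProbabilityMeasure μ] (h : IsDirectedSBM B τ μ A)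
    (i j : Fin N) : ∫ ω, noise B τ (A ω) i j ∂μ = 0 := by
  by_cases hij : i = j
  · simp [noise, hij]
  have hset : MeasurableSet {ω | A ω i j = 1} := h.measurable_entry i j (measurableSet_singleton 1)
  have hind : (fun ω => A ω i j) = Set.indicator {ω | A ω i j = 1} fun _ => (1 : ℝ) := by
    ext ω
    rcases h.zero_or_one ω i j with h0 | h0 <;> simp [Set.indicator, h0]
  have hint : ∫ ω, A ω i j ∂μ = B (τ i) (τ j) := by
    rw [hind, integral_indicator_const _ hset, h.prob_edge i j hij, smul_eq_mul, mul_one]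
  have hintble : Integrable (fun ω => A ω i j) μ := by
    rw [hind]
    exact (integrable_const _).indicator hset
  simp only [noise, if_neg hij]
  rw [integral_sub hintble (integrable_const _), hint]
  simp

lemma IsDirectedSBM.hasSubgaussianMGF_noise [IsProbabilityMeasure μ] (h : IsDirectedSBM B τ μ A)
    (hB : ∀ i j, 0 ≤ B i j ∧ B i j ≤ 1) (i j : Fin N) :
    HasSubgaussianMGF (fun ω => noise B τ (A ω) i j) 1 μ := by
  simpa using hasSubgaussianMGF_mul (μ := μ) (h.measurable_noise i j) (measurable_const (a := 1))
    (fun ω => abs_noise_le hB (h.zero_or_one ω) i j) (by simp) (indepFun_const_right _ _)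
    (h.integral_noise i j)

/-- Hoeffding's inequality for the sum of the noise over a set of entries `g v`, `v ∈ s`. -/
lemma IsDirectedSBM.measureReal_sum_noise_gt_le [IsProbabilityMeasure μ]
    (h : IsDirectedSBM B τ μ A) (hB : ∀ i j, 0 ≤ B i j ∧ B i j ≤ 1)
    {g : Fin N → Fin N × Fin N} (hg : Function.Injective g) (s : Finset (Fin N)) {t : ℝ}
    (ht : 0 ≤ t) :
    μ.real {ω | t < |∑ v ∈ s, noise B τ (A ω) (g v).1 (g v).2|} ≤
      2 * Real.exp (-t ^ 2 / (2 * N)) := by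
  have h1 := HasSubgaussianMGF.sum_of_iIndepFun (h.iIndepFun_noise.precomp hg) (s := s)
    (c := fun _ => 1) fun v _ => h.hasSubgaussianMGF_noise hB (g v).1 (g v).2
  refine measureReal_abs_gt_le (hasSubgaussianMGF_mono h1 ?_) ht
  simpa using Finset.card_le_univ s

/-- Sums of products of entries in two different rows are sub-Gaussian: the products belonging to
different columns are independent. -/
lemma IsDirectedSBM.hasSubgaussianMGF_sum_mul [IsProbabilityMeasure μ]
    (h : IsDirectedSBM B τ μ A) (hB : ∀ i j, 0 ≤ B i j ∧ B i j ≤ 1) {u v : Fin N} (huv : u ≠ v)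
    (s : Finset (Fin N)) :
    HasSubgaussianMGF (fun ω => ∑ w ∈ s, noise B τ (A ω) u w * noise B τ (A ω) v w) s.card μ := by
  classical
  have hind := h.iIndepFun_noise
  have hmeas : ∀ p : Fin N × Fin N, Measurable fun ω => noise B τ (A ω) p.1 p.2 :=
    fun p => h.measurable_noise p.1 p.2
  induction s using Finset.induction_on with
  | empty => simp
  | insert a s ha ih =>
    have h1 : HasSubgaussianMGF (fun ω => noise B τ (A ω) u a * noise B τ (A ω) v a) 1 μ :=
      hasSubgaussianMGF_mul (h.measurable_noise u a) (h.measurable_noise v a)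
        (fun ω => abs_noise_le hB (h.zero_or_one ω) u a)
        (fun ω => abs_noise_le hB (h.zero_or_one ω) v a)
        (hind.indepFun (i := (u, a)) (j := (v, a)) fun h => huv (congrArg Prod.fst h))
        (h.integral_noise u a)
    have hdisj : Disjoint (({u, v} : Finset (Fin N)) ×ˢ {a}) (({u, v} : Finset (Fin N)) ×ˢ s) := by
      rw [Finset.disjoint_left]
      rintro ⟨x, y⟩ hx hy
      rw [Finset.mem_product] at hx hy
      exact ha (Finset.mem_singleton.1 hx.2 ▸ hy.2)
    have hpair := hind.indepFun_finset _ _ hdisj hmeas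
    have hmem : ∀ x ∈ ({u, v} : Finset (Fin N)), ∀ t : Finset (Fin N), ∀ w ∈ t,
        (x, w) ∈ ({u, v} : Finset (Fin N)) ×ˢ t := fun x hx t w hw =>
      Finset.mem_product.2 ⟨hx, hw⟩
    have hu : u ∈ ({u, v} : Finset (Fin N)) := by simp
    have hv : v ∈ ({u, v} : Finset (Fin N)) := by simp
    have hind2 : IndepFun (fun ω => noise B τ (A ω) u a * noise B τ (A ω) v a)
        (fun ω => ∑ w ∈ s, noise B τ (A ω) u w * noise B τ (A ω) v w) μ := by
      have hφ : Measurable fun x : ↥(({u, v} : Finset (Fin N)) ×ˢ ({a} : Finset (Fin N))) → ℝ =>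
          x ⟨(u, a), hmem u hu _ a (by simp)⟩ * x ⟨(v, a), hmem v hv _ a (by simp)⟩ := by
        fun_prop
      have hψ : Measurable fun x : ↥(({u, v} : Finset (Fin N)) ×ˢ s) → ℝ =>
          ∑ w ∈ s.attach, x ⟨(u, w.1), hmem u hu _ w.1 w.2⟩ *
            x ⟨(v, w.1), hmem v hv _ w.1 w.2⟩ := by
        fun_prop
      have := hpair.comp hφ hψ
      rw [show (fun ω => ∑ w ∈ s, noise B τ (A ω) u w * noise B τ (A ω) v w) =
        fun ω => ∑ w ∈ s.attach, noise B τ (A ω) u w.1 * noise B τ (A ω) v w.1 from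
          funext fun ω => (Finset.sum_attach s
            fun w => noise B τ (A ω) u w * noise B τ (A ω) v w).symm]
      exact this
    have h2 := h1.add_of_indepFun ih hind2
    rw [Finset.card_insert_of_notMem ha]
    convert! h2 using 1
    · ext ω
      simp [Finset.sum_insert ha]
    · push_cast
      ring

/-- The event on which the noise is small: its sums over blocks, in rows and in columns, are at most
`η N`, and so are the inner products of distinct rows. -/
def smallNoise (B : Matrix (Fin K) (Fin K) ℝ) (τ : Fin N → Fin K)
    (A : Ω → Matrix (Fin N) (Fin N) ℝ) (η : ℝ) : Set Ω :=
  {ω | (∀ u j, |∑ v with τ v = j, noise B τ (A ω) u v| ≤ η * N) ∧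
    (∀ v j, |∑ u with τ u = j, noise B τ (A ω) u v| ≤ η * N) ∧
    ∀ u v, u ≠ v → |∑ w, noise B τ (A ω) u w * noise B τ (A ω) v w| ≤ η * N}

lemma IsDirectedSBM.measureReal_compl_smallNoise_le [IsProbabilityMeasure μ]
    (h : IsDirectedSBM B τ μ A) (hB : ∀ i j, 0 ≤ B i j ∧ B i j ≤ 1) {η : ℝ} (hη : 0 ≤ η) :
    μ.real (smallNoise B τ A η)ᶜ ≤
      (2 * (N * K) + N * N) * (2 * Real.exp (-(η * N) ^ 2 / (2 * N))) := by
  set q := 2 * Real.exp (-(η * N) ^ 2 / (2 * N)) with hq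
  have hq0 : 0 ≤ q := by positivity
  have ht : 0 ≤ η * N := by positivity
  let bad : ((Fin N × Fin K) ⊕ (Fin N × Fin K)) ⊕ (Fin N × Fin N) → Set Ω := fun x =>
    match x with
    | Sum.inl (Sum.inl p) => {ω | η * N < |∑ v with τ v = p.2, noise B τ (A ω) p.1 v|}
    | Sum.inl (Sum.inr p) => {ω | η * N < |∑ u with τ u = p.2, noise B τ (A ω) u p.1|}
    | Sum.inr p => {ω | p.1 ≠ p.2 ∧
        η * N < |∑ w, noise B τ (A ω) p.1 w * noise B τ (A ω) p.2 w|}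
  have hcover : (smallNoise B τ A η)ᶜ ⊆ ⋃ x, bad x := by
    intro ω hω
    by_contra hnot
    rw [Set.mem_iUnion, not_exists] at hnot
    refine hω ⟨fun u j => not_lt.1 fun hlt => hnot (Sum.inl (Sum.inl (u, j))) hlt,
      fun v j => not_lt.1 fun hlt => hnot (Sum.inl (Sum.inr (v, j))) hlt,
      fun u v huv => not_lt.1 fun hlt => hnot (Sum.inr (u, v)) ⟨huv, hlt⟩⟩
  have hbad : ∀ x, μ.real (bad x) ≤ q := by
    rintro ((⟨u, j⟩ | ⟨v, j⟩) | ⟨u, v⟩)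
    · exact h.measureReal_sum_noise_gt_le hB (g := fun v => (u, v))
        (fun a b hab => congrArg Prod.snd hab) _ ht
    · exact h.measureReal_sum_noise_gt_le hB (g := fun u => (u, v))
        (fun a b hab => congrArg Prod.fst hab) _ ht
    · by_cases huv : u = v
      · simpa [bad, huv] using hq0
      · have h1 := h.hasSubgaussianMGF_sum_mul hB huv Finset.univ
        rw [Finset.card_univ, Fintype.card_fin] at h1
        simpa [bad, huv] using measureReal_abs_gt_le h1 ht
  calc μ.real (smallNoise B τ A η)ᶜ ≤ μ.real (⋃ x, bad x) := measureReal_mono hcover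
    _ ≤ ∑ x, μ.real (bad x) := measureReal_iUnion_fintype_le bad
    _ ≤ ∑ _x : ((Fin N × Fin K) ⊕ (Fin N × Fin K)) ⊕ (Fin N × Fin N), q :=
        Finset.sum_le_sum fun x _ => hbad x
    _ = (2 * (N * K) + N * N) * q := by
        rw [Finset.sum_const, Finset.card_univ, nsmul_eq_mul]
        simp only [Fintype.card_sum, Fintype.card_prod, Fintype.card_fin]
        push_cast
        ring

end SBM

/-- The failure probability from the union bound is eventually below `2 / N²`. -/
lemma eventually_union_bound_le (K : ℕ) {η : ℝ} (hη : 0 < η) :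
    ∀ᶠ N : ℕ in atTop, (2 * ((N : ℝ) * K) + N * N) *
      (2 * Real.exp (-(η * N) ^ 2 / (2 * N))) ≤ 2 / (N : ℝ) ^ 2 := by
  have h1 := isLittleO_pow_exp_pos_mul_atTop 4 (show 0 < η ^ 2 / 2 by positivity)
  have h2 := (h1.bound (c := 1 / (2 * K + 1)) (by positivity))
  filter_upwards [tendsto_natCast_atTop_atTop.eventually h2, eventually_gt_atTop 0] with N hN hN0
  have hN1 : (1 : ℝ) ≤ N := by exact_mod_cast hN0
  have hNpos : (0 : ℝ) < N := by linarith
  rw [Real.norm_of_nonneg (by positivity), Real.norm_of_nonneg (by positivity),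
    one_div_mul_eq_div, le_div_iff₀ (by positivity)] at hN
  have h3 : -(η * N) ^ 2 / (2 * N) = -(η ^ 2 / 2 * N) := by field_simp
  rw [h3, Real.exp_neg, le_div_iff₀ (by positivity)]
  have hE := Real.exp_pos (η ^ 2 / 2 * N)
  rw [show (2 * ((N : ℝ) * K) + N * N) * (2 * (Real.exp (η ^ 2 / 2 * N))⁻¹) * (N : ℝ) ^ 2 =
    2 * ((2 * (N * K) + N * N) * (N : ℝ) ^ 2) / Real.exp (η ^ 2 / 2 * N) by field_simp,
    div_le_iff₀ hE]
  have h4 : (2 * (N * K) + N * N) * (N : ℝ) ^ 2 ≤ (N : ℝ) ^ 4 * (2 * K + 1) := by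
    have : (N : ℝ) * K ≤ N * N * K := by
      have hK : (0 : ℝ) ≤ K := by positivity
      nlinarith [mul_nonneg hNpos.le hK]
    nlinarith [sq_nonneg (N : ℝ)]
  linarith

/-- With probability at least `1 - 2 / N²`, the adjacency matrix and its transpose are close to
the block matrix and its transpose. -/
theorem eventually_isCloseToBlock {K : ℕ} {B : Matrix (Fin K) (Fin K) ℝ}
    (hB : ∀ i j, 0 ≤ B i j ∧ B i j ≤ 1) {ε : ℝ} (hε : 0 < ε) :
    ∃ N₀ : ℕ, ∀ N : ℕ, N₀ ≤ N → ∀ τ : Fin N → Fin K,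
      ∀ (Ω : Type*) [MeasurableSpace Ω] (P : Measure Ω) [IsProbabilityMeasure P]
        (A : Ω → Matrix (Fin N) (Fin N) ℝ), IsDirectedSBM B τ P A →
        1 - 2 / (N : ℝ) ^ 2 ≤ P.real {ω | IsCloseToBlock B τ (A ω) ε ∧
          IsCloseToBlock B.transpose τ (A ω).transpose ε} := by
  -- the first bound on `η` makes the operator norm small, the second the block sums
  set η := min ((ε / 2) ^ 2 / 2) (ε / 2) with hη
  have hη0 : 0 < η := lt_min (by positivity) (by positivity)
  have hηε : 2 * η ^ 2 ≤ (ε / 2) ^ 4 := by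
    have h1 : η ^ 2 ≤ ((ε / 2) ^ 2 / 2) ^ 2 := by
      gcongr
      exact min_le_left _ _
    have h2 : 0 ≤ (ε / 2) ^ 4 := by positivity
    nlinarith
  have hev : ∀ᶠ N : ℕ in atTop, (2 * ((N : ℝ) * K) + N * N) *
      (2 * Real.exp (-(η * N) ^ 2 / (2 * N))) ≤ 2 / (N : ℝ) ^ 2 ∧
      1 ≤ η ^ 2 * N ∧ 1 ≤ ε / 2 * N :=
    (eventually_union_bound_le K hη0).and
      (((tendsto_natCast_atTop_atTop.const_mul_atTop (by positivity)).eventually_ge_atTop 1).and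
      ((tendsto_natCast_atTop_atTop.const_mul_atTop (by positivity)).eventually_ge_atTop 1))
  obtain ⟨N₀, hN₀⟩ := eventually_atTop.1 hev
  refine ⟨N₀, fun N hN τ Ω _ P _ A hA => ?_⟩
  obtain ⟨hprob, hN1, hN2⟩ := hN₀ N hN
  have hsub : smallNoise B τ A η ⊆ {ω | IsCloseToBlock B τ (A ω) ε ∧
      IsCloseToBlock B.transpose τ (A ω).transpose ε} := by
    rintro ω ⟨h1, h2, h3⟩
    have hnorm := norm_noise_le hB (hA.zero_or_one ω) (by positivity) hηε hN1 h3
    have hηN : η * N ≤ ε / 2 * N := by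
      gcongr
      exact min_le_right _ _
    refine ⟨isCloseToBlock_of_noise hB (hA.zero_or_one ω) (hA.no_loops ω) hN2 hnorm
      fun u j => (h1 u j).trans hηN, isCloseToBlock_of_noise (fun i j => hB j i)
      (fun i j => hA.zero_or_one ω j i) (fun i => hA.no_loops ω i) hN2 ?_ fun u j => ?_⟩
    · rwa [noise_transpose, l2_opNorm_transpose]
    · rw [noise_transpose]
      exact (h2 u j).trans hηN
  have h1 := (hA.measureReal_compl_smallNoise_le hB hη0.le).trans hprob
  have h2 : 1 ≤ P.real (smallNoise B τ A η) + P.real (smallNoise B τ A η)ᶜ := by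
    have := measureReal_union_le (μ := P) (smallNoise B τ A η) (smallNoise B τ A η)ᶜ
    rwa [Set.union_compl_self, probReal_univ] at this
  have h3 := measureReal_mono (μ := P) hsub
  linarith

/-! ### The separation hypothesis in terms of `B` -/

/-- In a full-rank factorisation `M = X Yᵀ`, equal rows of `M` come from equal rows of `X`. -/
lemma row_eq_of_factorization {K d : ℕ} {M : Matrix (Fin K) (Fin K) ℝ}
    {X Y : Matrix (Fin K) (Fin d) ℝ} (h : M = X * Y.transpose) (hr : d ≤ M.rank) {i j : Fin K}
    (hij : M i = M j) : X i = X j := by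
  have hY : d ≤ Y.rank := by
    rw [h] at hr
    exact hr.trans ((Matrix.rank_mul_le_right _ _).trans Y.rank_transpose.le)
  have hker : LinearMap.ker Y.mulVecLin = ⊥ := by
    rw [← Submodule.finrank_eq_zero (R := ℝ)]
    have h1 := Y.mulVecLin.finrank_range_add_finrank_ker
    have h2 : Y.rank = Module.finrank ℝ (LinearMap.range Y.mulVecLin) := rfl
    rw [Module.finrank_fin_fun] at h1
    omega
  refine LinearMap.ker_eq_bot.1 hker ?_
  have hrow : ∀ a, Y.mulVec (X a) = M a := by
    intro a
    ext b
    rw [h, Matrix.mul_apply]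
    simp only [Matrix.mulVec, dotProduct, Matrix.transpose_apply, mul_comm]
  change Y.mulVec (X i) = Y.mulVec (X j)
  rw [hrow, hrow, hij]

lemma doubledBlockMatrix_row_eq {N K : ℕ} {B : Matrix (Fin K) (Fin K) ℝ} (τ : Fin N → Fin K)
    {i j : Fin K} (h : B i = B j) : doubledBlockMatrix B τ i = doubledBlockMatrix B τ j := by
  ext l
  simp only [doubledBlockMatrix, Matrix.mul_assoc]
  rw [Matrix.mul_apply, Matrix.mul_apply, h]

/-- If no two indices have equal rows in both factors of a full-rank factorisation of `B̃`, then
no two indices have both equal rows and equal columns in `B`. -/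
lemma row_ne_or_column_ne {N K d : ℕ} {B : Matrix (Fin K) (Fin K) ℝ} {τ : Fin N → Fin K}
    {X Y : Matrix (Fin K) (Fin d) ℝ} (h : doubledBlockMatrix B τ = X * Y.transpose)
    (hr : d ≤ (doubledBlockMatrix B τ).rank) {i j : Fin K} (hij : X i ≠ X j ∨ Y i ≠ Y j) :
    B i ≠ B j ∨ B.transpose i ≠ B.transpose j := by
  refine hij.imp (fun hX hB => hX ?_) (fun hY hB => hY ?_)
  · exact row_eq_of_factorization h hr (doubledBlockMatrix_row_eq τ hB)
  · have hT : doubledBlockMatrix B.transpose τ = Y * X.transpose := by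
      rw [doubledBlockMatrix_transpose, h, Matrix.transpose_mul, Matrix.transpose_transpose]
    refine row_eq_of_factorization hT ?_ (doubledBlockMatrix_row_eq τ hB)
    rwa [doubledBlockMatrix_transpose, Matrix.rank_transpose]

lemma row_ne_of_lt_rowDist {m n : ℕ} {M : Matrix (Fin m) (Fin n) ℝ} {i j : Fin m} {c : ℝ}
    (hc : 0 ≤ c) (h : c < rowDist M i j) : M i ≠ M j := by
  intro hij
  have : rowDist M i j = 0 := by simp [rowDist, hij]
  linarith

end DASE

theorem theorem1 {K d : ℕ} (B : Matrix (Fin K) (Fin K) ℝ)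
    (hB : ∀ i j, 0 ≤ B i j ∧ B i j ≤ 1) (hd : B.rank = d)
    (πt bt βh : ℝ) (hπ : 0 < πt) (hb : 0 < bt) (hβ : 0 < βh) :
    ∃ N₀ : ℕ, ∀ N : ℕ, N₀ ≤ N → ∀ τ : Fin N → Fin K,
      (∀ i, πt * N ≤ DASE.blockSize τ i) →
      bt * N ≤ DASE.singularValue (DASE.doubledBlockMatrix B τ) d →
      ∀ νt μt : Matrix (Fin K) (Fin d) ℝ,
        DASE.doubledBlockMatrix B τ = νt * μt.transpose →
        (∀ u v, u ≠ v → βh * N < DASE.rowDist νt u v ∨ βh * N < DASE.rowDist μt u v) →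
      ∀ (Ω : Type*) [MeasurableSpace Ω] (P : Measure Ω) [IsProbabilityMeasure P]
        (A : Ω → Matrix (Fin N) (Fin N) ℝ), DASE.IsDirectedSBM B τ P A →
        1 - 2 / (N : ℝ) ^ 2 ≤
          P.real {ω | ∀ U V : Matrix (Fin N) (Fin d) ℝ, DASE.IsTopSVD (A ω * A ω) U V →
            ∀ (ν : Matrix (Fin K) (Fin d ⊕ Fin d) ℝ) (τh : Fin N → Fin K),
              DASE.IsKMeans (Matrix.fromCols U V) ν τh →
              (DASE.misclustered τ τh : ℝ) ≤
                2 ^ 5 * 3 ^ 2 / (βh ^ 2 * (bt * πt) ^ 5) * (Real.log N / N)} := by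
  subst hd
  obtain ⟨ε, hε, hrec⟩ := DASE.exists_misclustered_eq_zero hB hπ hb
  obtain ⟨N₀, hN₀⟩ := DASE.eventually_isCloseToBlock hB hε
  refine ⟨max N₀ 1, fun N hN τ hτ hsv νt μt hfac hsep Ω _ P _ A hA => ?_⟩
  have hNpos : 0 < N := (le_max_right N₀ 1).trans hN
  have hNR : (0 : ℝ) < N := by exact_mod_cast hNpos
  have hrank : B.rank ≤ (DASE.doubledBlockMatrix B τ).rank :=
    (DASE.stretchesSubspace_of_le_singularValue _ (by positivity) hsv).le_rank (by positivity)
  have hdist : ∀ i j, i ≠ j → B i ≠ B j ∨ B.transpose i ≠ B.transpose j := fun i j hij =>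
    DASE.row_ne_or_column_ne hfac hrank ((hsep i j hij).imp
      (DASE.row_ne_of_lt_rowDist (by positivity)) (DASE.row_ne_of_lt_rowDist (by positivity)))
  refine (hN₀ N ((le_max_left N₀ 1).trans hN) τ Ω P A hA).trans (measureReal_mono ?_)
  rintro ω ⟨h1, h2⟩ U V hUV ν τh hkm
  rw [hrec N τ hNpos hτ hsv hdist (A ω) h1 h2 U V hUV ν τh hkm, Nat.cast_zero]
  have hlog : 0 ≤ Real.log N := Real.log_natCast_nonneg N
  positivity
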